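/- Let $n,m$ be positive integers, $X=(x_1,\dots,x_n)$ and $Y=(y_1,\dots,y_m)$ commuting indeterminates, and $\bar x_i=1/x_i$. An orthosymplectic tableau of shape $\lambda$ is a filling of the Young diagram of $\lambda$ with letters from $1<\bar 1<2<\bar 2<\cdots<n<\bar n<1'<2'<\cdots<m'$ such that (a) the cells with unprimed entries form a Young diagram, and its entries increase weakly along rows and strictly down columns, those in the $i$-th row being at least $i$; (b) the primed entries increase strictly along rows and weakly down columns. Its weight is the product over all cells of $x_i$ for an entry $i$, $\bar x_i$ for an entry $\bar i$, and $y_j$ for an entry $j'$; the orthosymplectic Schur function $\mathrm{spo}_\lambda(X;Y)$ is the sum of the weights of all orthosymplectic tableaux of shape $\lambda$. **Theorem.** Let $\lambda$ be a partition of length at most $n$, let $\lambda'$ be its conjugate, and let $k=\min\{j\ge 1 : \lambda_j+n+1-j\le m\}$. Then, in the field of fractions of $\mathbb{Z}[x_1,\dots,x_n,y_1,\dots,y_m]$, $$\mathrm{spo}_\lambda(X;Y)=\frac{(-1)^{mn-n+k-1}}{D}\det\begin{pmatrix}R & X_\lambda\\ Y_\lambda & 0\end{pmatrix},$$ where $$R=\left(\frac{x_i}{(x_i+y_j)\prod_{q=1}^m(\bar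 x_i+y_q)}-\frac{\bar x_i}{(\bar x_i+y_j)\prod_{q=1}^m(x_i+y_q)}\right)_{1\le i\le n,\ 1\le j\le m},$$ $$X_\lambda=\left(\frac{x_i^{\lambda_j+n-m-j+1}}{\prod_{q=1}^m(\bar x_i+y_q)}-\frac{\bar x_i^{\lambda_j+n-m-j+1}}{\prod_{q=1}^m(x_i+y_q)}\right)_{1\le i\le n,\ 1\le j\le k-1},$$ $$Y_\lambda=\left(y_j^{\lambda'_i+m-n-i}\right)_{1\le i\le m-n+k-1,\ 1\le j\le m},$$ $$D=\frac{\prod_{i=1}^n(x_i-\bar x_i)\prod_{1\le i<j\le n}(x_i+\bar x_i-x_j-\bar x_j)\prod_{1\le i<j\le m}(y_i-y_j)}{\prod_{i=1}^n\prod_{j=1}^m(x_i+y_j)(\bar x_i+y_j)}.$$ -/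

import Mathlib

noncomputable section

/-- The alphabet `B = {1, 1̄, …, n, n̄} ∪ {1', …, m'}`: `inl (i, false)` is the letter `i`,
`inl (i, true)` is the letter `ī`, and `inr j` is the letter `j'` (indices start at zero). -/
abbrev OSPLetter (n m : ℕ) : Type := (Fin n × Bool) ⊕ Fin m

namespace OSPLetter

variable {n m : ℕ}

/-- The position of a letter in the total order `1 < 1̄ < 2 < 2̄ < ⋯ < n < n̄ < 1' < ⋯ < m'`. -/
def rank : OSPLetter n m → ℕ
  | Sum.inl (i, false) => 2 * (i : ℕ)
  | Sum.inl (i, true) => 2 * (i : ℕ) + 1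
  | Sum.inr j => 2 * n + (j : ℕ)

/-- The weight of a single letter: `x i` for `i`, `(x i)⁻¹` for `ī`, and `y j` for `j'`. -/
def wt {K : Type*} [Field K] (x : Fin n → K) (y : Fin m → K) : OSPLetter n m → K
  | Sum.inl (i, false) => x i
  | Sum.inl (i, true) => (x i)⁻¹
  | Sum.inr j => y j

end OSPLetter

/-- A filling `T` of the Young diagram `lam` (cells `(row, column)`, counted from zero) by letters
of `B` is an orthosymplectic tableau. -/
structure IsOSPTableau (n m : ℕ) (lam : YoungDiagram)
    (T : {c // c ∈ lam.cells} → OSPLetter n m) : Prop where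
  /-- The cells with entries in `B₀ = {1, 1̄, …, n, n̄}` form a Young diagram. -/
  shape : ∀ c d, c.1.1 ≤ d.1.1 → c.1.2 ≤ d.1.2 → (T d).isLeft → (T c).isLeft
  /-- Among the entries from `B₀`, rows increase weakly. -/
  row_weak : ∀ c d, c.1.1 = d.1.1 → c.1.2 < d.1.2 → (T c).isLeft → (T d).isLeft →
    (T c).rank ≤ (T d).rank
  /-- Among the entries from `B₀`, columns increase strictly. -/
  col_strict : ∀ c d, c.1.2 = d.1.2 → c.1.1 < d.1.1 → (T c).isLeft → (T d).isLeft →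
    (T c).rank < (T d).rank
  /-- The entries from `B₀` in the `i`-th row are at least the letter `i`. -/
  row_bound : ∀ c, (T c).isLeft → 2 * c.1.1 ≤ (T c).rank
  /-- Among the primed entries, rows increase strictly. -/
  row_strict' : ∀ c d, c.1.1 = d.1.1 → c.1.2 < d.1.2 → (T c).isRight → (T d).isRight →
    (T c).rank < (T d).rank
  /-- Among the primed entries, columns increase weakly. -/
  col_weak' : ∀ c d, c.1.2 = d.1.2 → c.1.1 < d.1.1 → (T c).isRight → (T d).isRight →
    (T c).rank ≤ (T d).rank

open Classical in
/-- The orthosymplectic Schur function `spo_lam(x; y)`: the sum of the weights of all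
orthosymplectic tableaux of shape `lam`. -/
def spo {n m : ℕ} {K : Type*} [Field K] (lam : YoungDiagram) (x : Fin n → K) (y : Fin m → K) : K :=
  ∑ T : {c // c ∈ lam.cells} → OSPLetter n m with IsOSPTableau n m lam T, ∏ c, (T c).wt x y

section Blocks

variable {n m : ℕ} {K : Type*} [Field K]

/-- The `n × m` block `R`. -/
def blockR (x : Fin n → K) (y : Fin m → K) : Matrix (Fin n) (Fin m) K :=
  Matrix.of fun i j =>
    x i / ((x i + y j) * ∏ q, ((x i)⁻¹ + y q)) -
      (x i)⁻¹ / (((x i)⁻¹ + y j) * ∏ q, (x i + y q))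

/-- The `n × r` block `X_lam`; the column `j : Fin r` is the one numbered `j + 1`. -/
def blockX (lam : YoungDiagram) (x : Fin n → K) (y : Fin m → K) (r : ℕ) :
    Matrix (Fin n) (Fin r) K :=
  Matrix.of fun i j =>
    x i ^ ((lam.rowLen j : ℤ) + n - m - ((j : ℤ) + 1) + 1) / (∏ q, ((x i)⁻¹ + y q)) -
      (x i)⁻¹ ^ ((lam.rowLen j : ℤ) + n - m - ((j : ℤ) + 1) + 1) / (∏ q, (x i + y q))

/-- The `p × m` block `Y_lam`; the row `i : Fin p` is the one numbered `i + 1`, and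
`lam.colLen i` is the corresponding part of the conjugate partition. -/
def blockY (n : ℕ) (lam : YoungDiagram) (y : Fin m → K) (p : ℕ) : Matrix (Fin p) (Fin m) K :=
  Matrix.of fun i j => y j ^ ((lam.colLen i : ℤ) + m - n - ((i : ℤ) + 1))

/-- The product `D`. -/
def spoD (x : Fin n → K) (y : Fin m → K) : K :=
  ((∏ i, (x i - (x i)⁻¹)) *
      (∏ i, ∏ j with i < j, (x i + (x i)⁻¹ - x j - (x j)⁻¹)) *
      (∏ i, ∏ j with i < j, (y i - y j))) /
    (∏ i, ∏ j, (x i + y j) * ((x i)⁻¹ + y j))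

end Blocks

/-- The determinant of the block matrix with blocks `A` (top left), `B` (top right), `C` (bottom
left) and `0` (bottom right), when its numbers of rows and columns agree. -/
def blockDet {K : Type*} [Field K] {n p m r : ℕ} (h : n + p = m + r) (A : Matrix (Fin n) (Fin m) K)
    (B : Matrix (Fin n) (Fin r) K) (C : Matrix (Fin p) (Fin m) K) : K :=
  ((Matrix.fromBlocks A B C 0).submatrix (fun s : Fin (n + p) => finSumFinEquiv.symm s)
    (fun s : Fin (n + p) => finSumFinEquiv.symm (Fin.cast h s))).det

/-- The set whose least element is `k`: the integers `j ≥ 1` with `lam_j + n + 1 - j ≤ m`. -/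
def kSet (n m : ℕ) (lam : YoungDiagram) : Set ℕ :=
  {j | 1 ≤ j ∧ (lam.rowLen (j - 1) : ℤ) + n + 1 - j ≤ m}

/-- The block matrix is square: `n + (m - n + k - 1) = m + (k - 1)`, and the subtractions are
not truncated. -/
theorem block_size {n m k : ℕ} {lam : YoungDiagram} (hk : IsLeast (kSet n m lam) k) :
    n + (m + k - 1 - n) = m + (k - 1) := by
  obtain ⟨h1, h2⟩ := hk.1
  omega

/-- The field of fractions of `ℤ[x₁, …, xₙ, y₁, …, yₘ]`. -/
abbrev XYField (n m : ℕ) : Type := FractionRing (MvPolynomial (Fin n ⊕ Fin m) ℤ)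

/-- The indeterminates `x₁, …, xₙ`. -/
def xVar (n m : ℕ) (i : Fin n) : XYField n m :=
  algebraMap (MvPolynomial (Fin n ⊕ Fin m) ℤ) (XYField n m) (MvPolynomial.X (Sum.inl i))

/-- The indeterminates `y₁, …, yₘ`. -/
def yVar (n m : ℕ) (j : Fin m) : XYField n m :=
  algebraMap (MvPolynomial (Fin n ⊕ Fin m) ℤ) (XYField n m) (MvPolynomial.X (Sum.inr j))

end

/-!
All shapes that occur have at most `n` rows, and are recorded by their shifted parts
`l j = lam j + n - j` (`j` counted from zero), which are positive and strictly decreasing.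

Removing the cells with the largest letter from a tableau removes a horizontal strip if the letter
is unprimed, and a vertical strip if it is primed (`rankSum_succ`). In terms of shifted parts, a
sum over strips becomes a sum over a product of intervals; the sequences in it that do not come
from a partition contribute nothing to a determinant with rows `g (l j)`, so that by
multilinearity such determinants stay determinants under both operations
(`sum_horizontal_strips`, `sum_vertical_strips`).

With the two letters `n` and `n̄` removed together, this proves the Weyl character formula for the
sum over symplectic tableaux (`vandProd_mul_rankSum`), by induction on `n`. With the primed letters
added, it expresses `spo` as the quotient of `det (A_{l j} (x i))` by the symplectic Weyl
denominator (`mul_rankSum_eq_det_ospEntry`), where `A_l (x)` is the antisymmetrization under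
`x ↦ x⁻¹` of the coefficient of `t ^ l` in `∏ q, (1 + y q * t) / (1 - x * t)`.

It remains to compare this with the block matrix. Expanding the entries of `R` in powers of `y j`
by Horner's scheme shows that the coefficient of `y j ^ (m - c)` is `± A_c (x i)`, up to a factor
that depends on `i` only; when the shifted part `l j` exceeds `m`, the entry of `X_lam` is
`A_{l j} (x i)` up to the same factor; and the exponents of `Y_lam` are `m - c` for the `c ≤ m`
that are not shifted parts. Hence a Vandermonde matrix splits off on the right
(`IsSplitting.fromBlocks_eq`), and what remains has unit vectors in its lower rows. A permutation
of its columns makes it block triangular, with `det (A_{l j} (x i))` in the corner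
(`IsSplitting.det_coreMatrix`); the sign of the permutation is computed by counting inversions.
-/

/-! ### Tableaux as fillings by ranks, and removal of the largest letter -/

section Tableaux

open Finset

variable {K : Type*} [CommRing K]

/-- A filling `f` of `lam` by ranks of letters is an orthosymplectic tableau; the ranks below `N`
are those of the unprimed letters. -/
structure IsRankTableau (N : ℕ) (lam : YoungDiagram) (f : {c // c ∈ lam.cells} → ℕ) : Prop where
  row : ∀ c d, c.1.1 = d.1.1 → c.1.2 < d.1.2 → f c < f d ∨ f c = f d ∧ f c < N
  col : ∀ c d, c.1.2 = d.1.2 → c.1.1 < d.1.1 → f c < f d ∨ f c = f d ∧ N ≤ f c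
  bound : ∀ c, f c < N → 2 * c.1.1 ≤ f c

open Classical in
/-- The generating function of the tableaux of shape `lam` with all ranks below `t`, where a cell
of rank `r` has weight `w r`. -/
noncomputable def rankSum (N t : ℕ) (w : ℕ → K) (lam : YoungDiagram) : K :=
  ∑ f ∈ (Fintype.piFinset fun _ : {c // c ∈ lam.cells} => range t) with IsRankTableau N lam f,
    ∏ c, w (f c)

/-- The Young diagrams contained in `lam`. -/
noncomputable def subdiagrams (lam : YoungDiagram) : Finset YoungDiagram :=
  lam.cells.powerset.preimage YoungDiagram.cells
    (Function.Injective.injOn fun _ _ h => YoungDiagram.ext h)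

theorem mem_subdiagrams {lam mu : YoungDiagram} : mu ∈ subdiagrams lam ↔ mu ≤ lam := by
  rw [subdiagrams, Finset.mem_preimage, Finset.mem_powerset, YoungDiagram.cells_subset_iff]

/-- The cells of `lam` outside `mu` may all carry the letter of rank `t`: they form a horizontal
strip within the admissible rows if the letter is unprimed, and a vertical strip otherwise. -/
structure IsStrip (N t : ℕ) (lam mu : YoungDiagram) : Prop where
  horizontal : t < N → ∀ i j, (i + 1, j) ∈ lam → (i, j) ∈ mu
  bound : t < N → ∀ i j, (i, j) ∈ lam → (i, j) ∉ mu → 2 * i ≤ t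
  vertical : N ≤ t → ∀ i j, (i, j + 1) ∈ lam → (i, j) ∈ mu

theorem IsRankTableau.monotone {N : ℕ} {lam : YoungDiagram} {f : {c // c ∈ lam.cells} → ℕ}
    (hf : IsRankTableau N lam f) {c d : {c // c ∈ lam.cells}} (h : c.1 ≤ d.1) : f c ≤ f d := by
  have hrow : ∀ a b : {c // c ∈ lam.cells}, a.1.1 = b.1.1 → a.1.2 ≤ b.1.2 → f a ≤ f b := by
    intro a b h1 h2
    rcases h2.lt_or_eq with h2 | h2
    · have := hf.row a b h1 h2
      omega
    · rw [Subtype.ext (Prod.ext h1 h2)]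
  have hcol : ∀ a b : {c // c ∈ lam.cells}, a.1.2 = b.1.2 → a.1.1 ≤ b.1.1 → f a ≤ f b := by
    intro a b h1 h2
    rcases h2.lt_or_eq with h2 | h2
    · have := hf.col a b h1 h2
      omega
    · rw [Subtype.ext (Prod.ext h2 h1)]
  have he : (c.1.1, d.1.2) ∈ lam.cells := by
    have := d.2
    rw [YoungDiagram.mem_cells] at this ⊢
    exact lam.up_left_mem h.1 le_rfl this
  exact (hrow c ⟨_, he⟩ rfl h.2).trans (hcol ⟨_, he⟩ d rfl h.1)

/-- The diagram of the cells of `lam` whose rank is below `t`. -/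
noncomputable def belowDiagram {N : ℕ} {lam : YoungDiagram} {f : {c // c ∈ lam.cells} → ℕ}
    (hf : IsRankTableau N lam f) (t : ℕ) : YoungDiagram where
  cells := (lam.cells.attach.filter fun c => f c < t).map (Function.Embedding.subtype _)
  isLowerSet := by
    intro d c hcd hd
    simp only [coe_map, Function.Embedding.subtype_apply, Set.mem_image, Finset.mem_coe,
      mem_filter, mem_attach, true_and] at hd ⊢
    obtain ⟨d, hd, rfl⟩ := hd
    have hc : c ∈ lam.cells := lam.isLowerSet hcd d.2
    exact ⟨⟨c, hc⟩, (hf.monotone (c := ⟨c, hc⟩) hcd).trans_lt hd, rfl⟩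

theorem mem_belowDiagram {N : ℕ} {lam : YoungDiagram} {f : {c // c ∈ lam.cells} → ℕ}
    (hf : IsRankTableau N lam f) (t : ℕ) (c : ℕ × ℕ) :
    c ∈ belowDiagram hf t ↔ ∃ h : c ∈ lam.cells, f ⟨c, h⟩ < t := by
  simp [belowDiagram, ← YoungDiagram.mem_cells]

theorem isStrip_belowDiagram {N t : ℕ} {lam : YoungDiagram} {f : {c // c ∈ lam.cells} → ℕ}
    (hf : IsRankTableau N lam f) (ht : ∀ c, f c < t + 1) : IsStrip N t lam (belowDiagram hf t) := by
  refine ⟨fun h i j hij => ?_, fun h i j hij hn => ?_, fun h i j hij => ?_⟩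
  · have h1 : (i, j) ∈ lam.cells := lam.up_left_mem (Nat.le_succ i) le_rfl hij
    refine (mem_belowDiagram hf t _).2 ⟨h1, ?_⟩
    have h2 := ht ⟨_, hij⟩
    have h3 := hf.col ⟨_, h1⟩ ⟨_, hij⟩ rfl (Nat.lt_succ_self i)
    omega
  · have h2 := ht ⟨_, hij⟩
    have h3 : ¬ f ⟨_, hij⟩ < t := fun h3 => hn ((mem_belowDiagram hf t _).2 ⟨hij, h3⟩)
    have h4 := hf.bound ⟨_, hij⟩ (by omega)
    simp only at h4
    omega
  · have h1 : (i, j) ∈ lam.cells := lam.up_left_mem le_rfl (Nat.le_succ j) hij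
    refine (mem_belowDiagram hf t _).2 ⟨h1, ?_⟩
    have h2 := ht ⟨_, hij⟩
    have h3 := hf.row ⟨_, h1⟩ ⟨_, hij⟩ rfl (Nat.lt_succ_self j)
    omega

open Classical in
/-- The extension of a filling of `mu` to `lam` by the constant value `t`. -/
noncomputable def extendFilling (lam mu : YoungDiagram) (t : ℕ) (g : {c // c ∈ mu.cells} → ℕ) :
    {c // c ∈ lam.cells} → ℕ :=
  fun c => if h : c.1 ∈ mu.cells then g ⟨c.1, h⟩ else t

theorem isRankTableau_extendFilling {N t : ℕ} {lam mu : YoungDiagram}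
    (hs : IsStrip N t lam mu) {g : {c // c ∈ mu.cells} → ℕ} (hg : IsRankTableau N mu g)
    (ht : ∀ c, g c < t) : IsRankTableau N lam (extendFilling lam mu t g) := by
  have lower : ∀ c d : ℕ × ℕ, c ≤ d → d ∈ mu.cells → c ∈ mu.cells :=
    fun c d hcd hd => mu.isLowerSet hcd hd
  refine ⟨fun c d h1 h2 => ?_, fun c d h1 h2 => ?_, fun c h => ?_⟩
  · have hcd : c.1 ≤ d.1 := ⟨h1.le, h2.le⟩
    unfold extendFilling
    by_cases hd : d.1 ∈ mu.cells
    · rw [dif_pos hd, dif_pos (lower _ _ hcd hd)]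
      exact hg.row _ _ h1 h2
    · rw [dif_neg hd]
      by_cases hc : c.1 ∈ mu.cells
      · rw [dif_pos hc]
        exact Or.inl (ht _)
      · rw [dif_neg hc]
        refine Or.inr ⟨rfl, ?_⟩
        by_contra hN
        refine hc (hs.vertical (not_lt.1 hN) _ _ (lam.up_left_mem h1.le h2 d.2))
  · have hcd : c.1 ≤ d.1 := ⟨h2.le, h1.le⟩
    unfold extendFilling
    by_cases hd : d.1 ∈ mu.cells
    · rw [dif_pos hd, dif_pos (lower _ _ hcd hd)]
      exact hg.col _ _ h1 h2
    · rw [dif_neg hd]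
      by_cases hc : c.1 ∈ mu.cells
      · rw [dif_pos hc]
        exact Or.inl (ht _)
      · rw [dif_neg hc]
        refine Or.inr ⟨rfl, ?_⟩
        by_contra hN
        exact hc (hs.horizontal (not_le.1 hN) _ _ (lam.up_left_mem h2 h1.le d.2))
  · unfold extendFilling at h ⊢
    by_cases hc : c.1 ∈ mu.cells
    · rw [dif_pos hc] at h ⊢
      exact hg.bound _ h
    · rw [dif_neg hc] at h ⊢
      exact hs.bound h _ _ c.2 hc

theorem belowDiagram_extendFilling {N t : ℕ} {lam mu : YoungDiagram} (hle : mu ≤ lam)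
    {g : {c // c ∈ mu.cells} → ℕ} (ht : ∀ c, g c < t)
    (hg : IsRankTableau N lam (extendFilling lam mu t g)) : belowDiagram hg t = mu := by
  refine YoungDiagram.ext (Finset.ext fun c => ?_)
  rw [YoungDiagram.mem_cells, mem_belowDiagram]
  constructor
  · rintro ⟨h, h1⟩
    by_contra hc
    rw [extendFilling, dif_neg hc] at h1
    exact lt_irrefl _ h1
  · intro hc
    refine ⟨hle hc, ?_⟩
    rw [extendFilling, dif_pos hc]
    exact ht _

theorem prod_extendFilling {t : ℕ} {lam mu : YoungDiagram} (hle : mu ≤ lam) (w : ℕ → K)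
    (g : {c // c ∈ mu.cells} → ℕ) :
    ∏ c, w (extendFilling lam mu t g c) = w t ^ (lam.card - mu.card) * ∏ c, w (g c) := by
  classical
  let F : ℕ × ℕ → K := fun c => if h : c ∈ mu.cells then w (g ⟨c, h⟩) else w t
  have h1 : ∏ c, w (extendFilling lam mu t g c) = ∏ c ∈ lam.cells, F c := by
    rw [← Finset.prod_coe_sort lam.cells F]
    refine Finset.prod_congr rfl fun c _ => ?_
    simp only [F, extendFilling]
    split_ifs <;> rfl
  have h2 : ∏ c, w (g c) = ∏ c ∈ mu.cells, F c := by
    rw [← Finset.prod_coe_sort mu.cells F]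
    refine Finset.prod_congr rfl fun c _ => ?_
    simp only [F]
    rw [dif_pos c.2]
  have h3 : ∏ c ∈ lam.cells \ mu.cells, F c = w t ^ (lam.card - mu.card) := by
    rw [← Finset.card_sdiff_of_subset (YoungDiagram.cells_subset_iff.2 hle)]
    refine Finset.prod_eq_pow_card fun c hc => ?_
    exact dif_neg (Finset.mem_sdiff.1 hc).2
  rw [h1, h2, ← h3, Finset.prod_sdiff (YoungDiagram.cells_subset_iff.2 hle)]

open Classical in
/-- Removing all cells with the largest letter from a tableau. -/
theorem rankSum_succ (N t : ℕ) (w : ℕ → K) (lam : YoungDiagram) :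
    rankSum N (t + 1) w lam =
      ∑ mu ∈ subdiagrams lam with IsStrip N t lam mu,
        w t ^ (lam.card - mu.card) * rankSum N t w mu := by
  let B : ({c // c ∈ lam.cells} → ℕ) → YoungDiagram := fun f =>
    if hf : IsRankTableau N lam f then belowDiagram hf t else ⊥
  have hB : ∀ {f} (hf : IsRankTableau N lam f), B f = belowDiagram hf t := fun hf => dif_pos hf
  rw [rankSum, ← Finset.sum_fiberwise_of_maps_to (g := B)
    (t := {mu ∈ subdiagrams lam | IsStrip N t lam mu})]
  · refine Finset.sum_congr rfl fun mu hmu => ?_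
    obtain ⟨hle, hs⟩ := Finset.mem_filter.1 hmu
    rw [mem_subdiagrams] at hle
    rw [rankSum, Finset.mul_sum]
    refine Finset.sum_bij' (fun f _ c => f ⟨c.1, hle c.2⟩) (fun g _ => extendFilling lam mu t g)
      ?_ ?_ ?_ ?_ ?_
    · intro f hf
      simp only [mem_filter, Fintype.mem_piFinset, mem_range] at hf ⊢
      obtain ⟨⟨h1, h2⟩, h3⟩ := hf
      rw [hB h2] at h3
      refine ⟨fun c => ?_, fun c d => h2.row ⟨c.1, hle c.2⟩ ⟨d.1, hle d.2⟩,
        fun c d => h2.col ⟨c.1, hle c.2⟩ ⟨d.1, hle d.2⟩, fun c => h2.bound ⟨c.1, hle c.2⟩⟩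
      have h4 : c.1 ∈ belowDiagram h2 t := h3.symm ▸ c.2
      exact ((mem_belowDiagram h2 t _).1 h4).2
    · intro g hg
      simp only [mem_filter, Fintype.mem_piFinset, mem_range] at hg ⊢
      have h1 := isRankTableau_extendFilling hs hg.2 hg.1
      refine ⟨⟨fun c => ?_, h1⟩, ?_⟩
      · unfold extendFilling
        split_ifs
        · exact (hg.1 _).trans (Nat.lt_succ_self t)
        · exact Nat.lt_succ_self t
      · rw [hB h1, belowDiagram_extendFilling hle hg.1]
    · intro f hf
      simp only [mem_filter, Fintype.mem_piFinset, mem_range] at hf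
      obtain ⟨⟨h1, h2⟩, h3⟩ := hf
      rw [hB h2] at h3
      funext c
      unfold extendFilling
      split_ifs with h
      · rfl
      · have h4 : ¬ f c < t := fun h4 => h (by
          rw [YoungDiagram.mem_cells, ← h3, mem_belowDiagram]
          exact ⟨c.2, h4⟩)
        have := h1 c
        omega
    · intro g hg
      funext c
      simp [extendFilling]
    · intro f hf
      simp only [mem_filter, Fintype.mem_piFinset, mem_range] at hf
      obtain ⟨⟨h1, h2⟩, h3⟩ := hf
      rw [hB h2] at h3
      rw [← prod_extendFilling hle w]
      refine Finset.prod_congr rfl fun c _ => ?_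
      unfold extendFilling
      split_ifs with h
      · rfl
      · have h4 : ¬ f c < t := fun h4 => h (by
          rw [YoungDiagram.mem_cells, ← h3, mem_belowDiagram]
          exact ⟨c.2, h4⟩)
        have := h1 c
        rw [show f c = t by omega]
  · intro f hf
    simp only [mem_filter, Fintype.mem_piFinset, mem_range, mem_subdiagrams] at hf ⊢
    rw [hB hf.2]
    refine ⟨fun c hc => ?_, isStrip_belowDiagram hf.2 hf.1⟩
    obtain ⟨h, -⟩ := (mem_belowDiagram hf.2 t c).1 hc
    exact h

theorem rankSum_bot (N t : ℕ) (w : ℕ → K) : rankSum N t w ⊥ = 1 := by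
  classical
  have : IsEmpty {c // c ∈ (⊥ : YoungDiagram).cells} := ⟨fun c => Finset.notMem_empty _ c.2⟩
  rw [rankSum, Finset.filter_true_of_mem]
  · simp
  · exact fun f _ => ⟨fun c => isEmptyElim c, fun c => isEmptyElim c, fun c => isEmptyElim c⟩

/-- By the condition on the rows, a tableau with few letters has few rows. -/
theorem rankSum_eq_zero {N t i : ℕ} (w : ℕ → K) {lam : YoungDiagram} (htN : t ≤ N)
    (hti : t ≤ 2 * i) (hi : lam.rowLen i ≠ 0) : rankSum N t w lam = 0 := by
  classical
  rw [rankSum, Finset.filter_false_of_mem, Finset.sum_empty]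
  intro f hf h
  have hc : (i, 0) ∈ lam := YoungDiagram.mem_iff_lt_rowLen.2 (Nat.pos_of_ne_zero hi)
  have h1 := h.bound ⟨(i, 0), hc⟩
  have h2 := Fintype.mem_piFinset.1 hf ⟨(i, 0), hc⟩
  simp only [mem_range] at h1 h2
  omega

end Tableaux

/-! ### Letters and their ranks -/

section Letters

variable {n m : ℕ}

theorem OSPLetter.rank_lt (a : OSPLetter n m) : a.rank < 2 * n + m := by
  rcases a with ⟨i, b⟩ | j
  · cases b <;> simp only [OSPLetter.rank] <;> omega
  · simp only [OSPLetter.rank]; omega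

theorem OSPLetter.isLeft_iff (a : OSPLetter n m) : a.isLeft ↔ a.rank < 2 * n := by
  rcases a with ⟨i, b⟩ | j
  · cases b <;> simp only [OSPLetter.rank, Sum.isLeft_inl, true_iff] <;> omega
  · simp [OSPLetter.rank]

theorem OSPLetter.isRight_iff (a : OSPLetter n m) : a.isRight ↔ 2 * n ≤ a.rank := by
  rw [← not_lt, ← OSPLetter.isLeft_iff]
  simp

theorem OSPLetter.rank_injective : Function.Injective (OSPLetter.rank (n := n) (m := m)) := by
  rintro (⟨i, a⟩ | i) (⟨j, b⟩ | j) h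
  · cases a <;> cases b <;> simp only [OSPLetter.rank] at h <;>
      first
      | omega
      | (obtain rfl : i = j := by omega
         rfl)
  · cases a <;> simp only [OSPLetter.rank] at h <;> omega
  · cases b <;> simp only [OSPLetter.rank] at h <;> omega
  · simp only [OSPLetter.rank] at h
    obtain rfl : i = j := by omega
    rfl

theorem OSPLetter.exists_rank {r : ℕ} (hr : r < 2 * n + m) : ∃ a : OSPLetter n m, a.rank = r := by
  by_cases h : r < 2 * n
  · rcases Nat.even_or_odd' r with ⟨i, rfl | rfl⟩
    · exact ⟨Sum.inl (⟨i, by omega⟩, false), rfl⟩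
    · exact ⟨Sum.inl (⟨i, by omega⟩, true), rfl⟩
  · exact ⟨Sum.inr ⟨r - 2 * n, by omega⟩, by simp only [OSPLetter.rank]; omega⟩

theorem isOSPTableau_iff {lam : YoungDiagram} (T : {c // c ∈ lam.cells} → OSPLetter n m) :
    IsOSPTableau n m lam T ↔ IsRankTableau (2 * n) lam fun c => (T c).rank := by
  constructor
  · intro h
    have key := fun c d h1 h2 => h.shape c d h1 h2
    simp only [OSPLetter.isLeft_iff] at key
    refine ⟨fun c d h1 h2 => ?_, fun c d h1 h2 => ?_, fun c hc => ?_⟩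
    · have a1 := h.row_weak c d h1 h2
      have a2 := h.row_strict' c d h1 h2
      have a3 := key c d h1.le h2.le
      simp only [OSPLetter.isLeft_iff, OSPLetter.isRight_iff] at a1 a2
      omega
    · have a1 := h.col_strict c d h1 h2
      have a2 := h.col_weak' c d h1 h2
      have a3 := key c d h2.le h1.le
      simp only [OSPLetter.isLeft_iff, OSPLetter.isRight_iff] at a1 a2
      omega
    · exact h.row_bound c ((OSPLetter.isLeft_iff _).2 hc)
  · intro h
    refine ⟨fun c d h1 h2 => ?_, fun c d h1 h2 => ?_, fun c d h1 h2 => ?_, fun c => ?_,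
      fun c d h1 h2 => ?_, fun c d h1 h2 => ?_⟩ <;>
      simp only [OSPLetter.isLeft_iff, OSPLetter.isRight_iff]
    · intro hd
      exact (h.monotone (c := c) (d := d) ⟨h1, h2⟩).trans_lt hd
    · have := h.row c d h1 h2
      omega
    · have := h.col c d h1 h2
      omega
    · exact h.bound c
    · have := h.row c d h1 h2
      omega
    · have := h.col c d h1 h2
      omega

theorem spo_eq_rankSum {K : Type*} [Field K] (lam : YoungDiagram) (x : Fin n → K) (y : Fin m → K)
    (w : ℕ → K) (hw : ∀ a : OSPLetter n m, w a.rank = a.wt x y) :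
    spo lam x y = rankSum (2 * n) (2 * n + m) w lam := by
  classical
  rw [spo, rankSum]
  refine Finset.sum_bij (fun T _ c => (T c).rank) ?_ ?_ ?_ ?_
  · intro T hT
    simp only [Finset.mem_filter, Finset.mem_univ, true_and] at hT
    simp only [Finset.mem_filter, Fintype.mem_piFinset, Finset.mem_range]
    exact ⟨fun c => (T c).rank_lt, (isOSPTableau_iff T).1 hT⟩
  · intro T _ T' _ h
    exact funext fun c => OSPLetter.rank_injective (congrFun h c)
  · intro f hf
    simp only [Finset.mem_filter, Fintype.mem_piFinset, Finset.mem_range] at hf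
    choose T hT using fun c => OSPLetter.exists_rank (hf.1 c)
    have hT' : (fun c => (T c).rank) = f := funext hT
    refine ⟨T, ?_, hT'⟩
    simp only [Finset.mem_filter, Finset.mem_univ, true_and]
    rw [isOSPTableau_iff, hT']
    exact hf.2
  · intro T _
    exact Finset.prod_congr rfl fun c _ => (hw _).symm

end Letters

/-! ### Sums over strips as determinants -/

section Strips

open Finset

variable {K : Type*} [CommRing K]

/-- The parts of `lam`, counted from zero, shifted by the staircase
`(n, n - 1, …, 1)`. The shift is zero from index `n` on, so that the shifted part there is `0` for
a diagram with at most `n` rows. -/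
noncomputable def shiftedPart (n : ℕ) (lam : YoungDiagram) (j : ℕ) : ℕ := lam.rowLen j + (n - j)

theorem shiftedPart_lt {n i j : ℕ} (lam : YoungDiagram) (hij : i < j) (hj : j ≤ n) :
    shiftedPart n lam j < shiftedPart n lam i := by
  have := lam.rowLen_anti i j hij.le
  unfold shiftedPart
  omega

theorem YoungDiagram.le_iff_rowLen {lam mu : YoungDiagram} :
    mu ≤ lam ↔ ∀ i, mu.rowLen i ≤ lam.rowLen i := by
  constructor
  · intro h i
    by_contra! hi
    exact lt_irrefl _ (YoungDiagram.mem_iff_lt_rowLen.1 (h (YoungDiagram.mem_iff_lt_rowLen.2 hi)))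
  · rintro h ⟨i, j⟩ hc
    exact YoungDiagram.mem_iff_lt_rowLen.2 ((YoungDiagram.mem_iff_lt_rowLen.1 hc).trans_le (h i))

theorem YoungDiagram.rowLen_eq_zero_of_le {lam : YoungDiagram} {n i : ℕ} (h : lam.rowLen n = 0)
    (hi : n ≤ i) : lam.rowLen i = 0 :=
  Nat.eq_zero_of_le_zero ((lam.rowLen_anti n i hi).trans h.le)

theorem YoungDiagram.card_eq_sum_rowLen {lam : YoungDiagram} {n : ℕ} (h : lam.rowLen n = 0) :
    lam.card = ∑ j : Fin n, lam.rowLen j := by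
  rw [Fin.sum_univ_eq_sum_range (fun j => lam.rowLen j) n]
  refine (Finset.card_eq_sum_card_fiberwise (f := Prod.fst) (t := range n) ?_).trans ?_
  · rintro ⟨i, j⟩ hc
    simp only [coe_range, Set.mem_Iio]
    by_contra! hi
    have := YoungDiagram.mem_iff_lt_rowLen.1 hc
    rw [YoungDiagram.rowLen_eq_zero_of_le h hi] at this
    omega
  · refine Finset.sum_congr rfl fun i _ => ?_
    rw [YoungDiagram.rowLen_eq_card]
    rfl

theorem StrictAnti.add_sub_le {n : ℕ} {b : Fin n → ℕ} (hb : StrictAnti b) {i j : Fin n}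
    (hij : i ≤ j) : b j + (j - i) ≤ b i := by
  obtain ⟨d, hd⟩ := Nat.exists_eq_add_of_le (Fin.le_def.1 hij)
  induction d generalizing j with
  | zero =>
    obtain rfl : i = j := Fin.ext (by omega)
    omega
  | succ d ih =>
    have h1 : (i : ℕ) + d < n := by omega
    have h2 := ih (j := ⟨i + d, h1⟩) (Fin.le_def.2 (by simp)) rfl
    have h3 : b j < b ⟨i + d, h1⟩ := hb (Fin.lt_def.2 (by simp only; omega))
    simp only at h2
    omega

/-- Every strictly decreasing sequence of positive integers is a sequence of shifted parts. -/
theorem exists_shiftedPart_eq {n : ℕ} {b : Fin n → ℕ} (hb : StrictAnti b) (hpos : ∀ j, 0 < b j) :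
    ∃ mu : YoungDiagram, mu.rowLen n = 0 ∧ ∀ j : Fin n, shiftedPart n mu j = b j := by
  classical
  have hn : ∀ j : Fin n, n - j ≤ b j := by
    intro j
    have hj := j.2
    have h1 := hb.add_sub_le (i := j) (j := ⟨n - 1, by omega⟩)
      (Fin.le_def.2 (by simp only; omega))
    have h2 := hpos ⟨n - 1, by omega⟩
    simp only at h1
    omega
  let mu : YoungDiagram :=
    { cells := (range n ×ˢ range (univ.sup b)).filter fun c =>
        ∃ h : c.1 < n, c.2 + (n - c.1) < b ⟨c.1, h⟩
      isLowerSet := by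
        rintro ⟨i', j'⟩ ⟨i, j⟩ ⟨h1, h2⟩ hd
        simp only [coe_filter, mem_product, mem_range, Set.mem_ofPred_eq] at h1 h2 hd ⊢
        obtain ⟨⟨h3, h4⟩, h5, h6⟩ := hd
        refine ⟨⟨by omega, by omega⟩, by omega, ?_⟩
        have h7 := hb.add_sub_le (i := ⟨i, by omega⟩) (j := ⟨i', h5⟩) (Fin.le_def.2 h1)
        simp only at h7
        omega }
  have hmem : ∀ i j, (i, j) ∈ mu ↔ ∃ h : i < n, j + (n - i) < b ⟨i, h⟩ := by
    intro i j
    rw [← YoungDiagram.mem_cells]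
    simp only [mu, mem_filter, mem_product, mem_range, and_iff_right_iff_imp]
    rintro ⟨h1, h2⟩
    have h3 : b ⟨i, h1⟩ ≤ univ.sup b := Finset.le_sup (mem_univ _)
    omega
  refine ⟨mu, ?_, fun j => ?_⟩
  · by_contra h
    obtain ⟨h1, -⟩ := (hmem n 0).1 (YoungDiagram.mem_iff_lt_rowLen.2 (Nat.pos_of_ne_zero h))
    exact lt_irrefl _ h1
  · have h1 : mu.rowLen j = b j - (n - j) := by
      refine eq_of_forall_lt_iff fun c => ?_
      rw [← YoungDiagram.mem_iff_lt_rowLen, hmem]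
      have := hn j
      exact ⟨fun ⟨_, h⟩ => by simp only [Fin.eta] at h; omega,
        fun h => ⟨j.2, by simp only [Fin.eta]; omega⟩⟩
    have := hn j
    rw [shiftedPart, h1]
    omega

open Classical in
/-- A sum over the diagrams whose shifted parts are prescribed to lie in sets `s j` is a sum over
all sequences in the product of the `s j`, if the summand vanishes at those sequences that are not
sequences of shifted parts. -/
theorem sum_subdiagrams_eq_sum_piFinset {n : ℕ} {lam : YoungDiagram} (hlam : lam.rowLen n = 0)
    (P : YoungDiagram → Prop) (s : Fin n → Finset ℕ) (c : K) (F : (Fin n → ℕ) → K)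
    (hP : ∀ mu ≤ lam, P mu ↔ ∀ j : Fin n, shiftedPart n mu j ∈ s j)
    (hF : ∀ b ∈ Fintype.piFinset s, F b ≠ 0 → StrictAnti b ∧ ∀ j, 0 < b j)
    (hle : ∀ j, ∀ a ∈ s j, a ≤ shiftedPart n lam j) :
    ∑ mu ∈ subdiagrams lam with P mu,
        c ^ (lam.card - mu.card) * F (fun j => shiftedPart n mu j) =
      ∑ b ∈ Fintype.piFinset s, (∏ j : Fin n, c ^ (shiftedPart n lam j - b j)) * F b := by
  have hmu : ∀ mu ≤ lam, mu.rowLen n = 0 := fun mu h =>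
    Nat.eq_zero_of_le_zero ((YoungDiagram.le_iff_rowLen.1 h n).trans hlam.le)
  refine Finset.sum_of_injOn (fun mu j => shiftedPart n mu j) ?_ ?_ ?_ ?_
  · intro mu h1 nu h2 h
    simp only [coe_filter, mem_subdiagrams, Set.mem_ofPred_eq] at h1 h2
    have key : ∀ i, mu.rowLen i = nu.rowLen i := by
      intro i
      by_cases hi : i < n
      · have := congrFun h ⟨i, hi⟩
        simp only [shiftedPart] at this
        omega
      · rw [YoungDiagram.rowLen_eq_zero_of_le (hmu _ h1.1) (not_lt.1 hi),
          YoungDiagram.rowLen_eq_zero_of_le (hmu _ h2.1) (not_lt.1 hi)]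
    exact le_antisymm (YoungDiagram.le_iff_rowLen.2 fun i => (key i).le)
      (YoungDiagram.le_iff_rowLen.2 fun i => (key i).ge)
  · intro mu h
    simp only [coe_filter, mem_subdiagrams, Set.mem_ofPred_eq] at h
    exact Fintype.mem_piFinset.2 ((hP mu h.1).1 h.2)
  · intro b hb hn
    by_cases h0 : F b = 0
    · rw [h0, mul_zero]
    · exfalso
      obtain ⟨h1, h2⟩ := hF b hb h0
      obtain ⟨mu, h3, h4⟩ := exists_shiftedPart_eq h1 h2
      have hb' := Fintype.mem_piFinset.1 hb
      have h5 : mu ≤ lam := by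
        refine YoungDiagram.le_iff_rowLen.2 fun i => ?_
        by_cases hi : i < n
        · have h6 := hle ⟨i, hi⟩ _ (hb' ⟨i, hi⟩)
          rw [← h4] at h6
          simp only [shiftedPart] at h6
          omega
        · rw [YoungDiagram.rowLen_eq_zero_of_le h3 (not_lt.1 hi)]
          exact Nat.zero_le _
      refine hn ⟨mu, ?_, funext h4⟩
      simp only [coe_filter, mem_subdiagrams, Set.mem_ofPred_eq]
      exact ⟨h5, (hP mu h5).2 fun j => by rw [h4]; exact hb' j⟩
  · intro mu h
    simp only [mem_filter, mem_subdiagrams] at h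
    rw [Finset.prod_pow_eq_pow_sum, YoungDiagram.card_eq_sum_rowLen hlam,
      YoungDiagram.card_eq_sum_rowLen (hmu mu h.1)]
    congr 2
    rw [← Finset.sum_tsub_distrib univ (f := fun j : Fin n => lam.rowLen j)
      (g := fun j : Fin n => mu.rowLen j) fun j _ => YoungDiagram.le_iff_rowLen.1 h.1 j]
    refine Finset.sum_congr rfl fun j _ => ?_
    simp only [shiftedPart]
    omega

theorem isStrip_iff_of_lt {n N t : ℕ} {lam mu : YoungDiagram} (hlam : lam.rowLen n = 0)
    (htN : t < N) (hnt : 2 * n ≤ t + 2) (hle : mu ≤ lam) :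
    IsStrip N t lam mu ↔ ∀ j : Fin n, shiftedPart n mu j ∈
      Ioc (shiftedPart n lam (j + 1)) (shiftedPart n lam j) := by
  have hmu := YoungDiagram.le_iff_rowLen.1 hle
  simp only [mem_Ioc, shiftedPart]
  constructor
  · intro h j
    have h1 : lam.rowLen (j + 1) ≤ mu.rowLen j := by
      by_contra! h2
      exact lt_irrefl _ (YoungDiagram.mem_iff_lt_rowLen.1
        (h.horizontal htN _ _ (YoungDiagram.mem_iff_lt_rowLen.2 h2)))
    have := hmu j
    omega
  · intro h
    have hlt : ∀ i j, (i, j) ∈ lam → i < n := by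
      intro i j hij
      by_contra! hi
      rw [YoungDiagram.mem_iff_lt_rowLen, YoungDiagram.rowLen_eq_zero_of_le hlam hi] at hij
      omega
    refine ⟨fun _ i j hij => ?_, fun _ i j hij _ => ?_, fun h' => absurd htN h'.not_gt⟩
    · have h1 := hlt _ _ hij
      have h2 := h ⟨i, by omega⟩
      rw [YoungDiagram.mem_iff_lt_rowLen] at hij ⊢
      simp only at h2
      omega
    · have h1 := hlt _ _ hij
      omega

theorem isStrip_iff_of_le {n N t : ℕ} {lam mu : YoungDiagram} (hlam : lam.rowLen n = 0)
    (hNt : N ≤ t) (hle : mu ≤ lam) :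
    IsStrip N t lam mu ↔ ∀ j : Fin n, shiftedPart n mu j ∈
      Icc (shiftedPart n lam j - 1) (shiftedPart n lam j) := by
  have hmu := YoungDiagram.le_iff_rowLen.1 hle
  simp only [mem_Icc, shiftedPart]
  constructor
  · intro h j
    have h1 : lam.rowLen j ≤ mu.rowLen j + 1 := by
      by_contra! h2
      exact lt_irrefl _ (YoungDiagram.mem_iff_lt_rowLen.1
        (h.vertical hNt _ _ (YoungDiagram.mem_iff_lt_rowLen.2 h2)))
    have := hmu j
    omega
  · intro h
    refine ⟨fun h' => absurd h' hNt.not_gt, fun h' => absurd h' hNt.not_gt, fun _ i j hij => ?_⟩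
    rw [YoungDiagram.mem_iff_lt_rowLen] at hij ⊢
    have h1 : i < n := by
      by_contra! hi
      rw [YoungDiagram.rowLen_eq_zero_of_le hlam hi] at hij
      omega
    have h2 := h ⟨i, h1⟩
    simp only at h2
    omega

/-- The convolution of a sequence of vectors `g 1, g 2, …` with the geometric sequence of `c`:
the `l`-th term is the sum of `c ^ (l - b) • g b` over `1 ≤ b ≤ l`. -/
def geomConv {n : ℕ} (c : K) (g : ℕ → Fin n → K) : ℕ → Fin n → K
  | 0 => 0
  | l + 1 => c • geomConv c g l + g (l + 1)

theorem sum_Ioc_eq_geomConv_sub {n : ℕ} (c : K) (g : ℕ → Fin n → K) {a b : ℕ} (h : a ≤ b) :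
    ∑ k ∈ Ioc a b, c ^ (b - k) • g k = geomConv c g b - c ^ (b - a) • geomConv c g a := by
  induction b, h using Nat.le_induction with
  | base => simp
  | succ b h ih =>
    have h1 : ∀ k ∈ Ioc a b, c ^ (b + 1 - k) • g k = c • c ^ (b - k) • g k := by
      intro k hk
      rw [smul_smul, ← pow_succ', Nat.succ_sub (mem_Ioc.1 hk).2]
    rw [Finset.sum_Ioc_succ_top (by omega), Finset.sum_congr rfl h1, ← Finset.smul_sum, ih,
      Nat.succ_sub h, geomConv, smul_sub, smul_smul, ← pow_succ']
    simp only [Nat.sub_self, pow_zero, one_smul]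
    abel

/-- Subtracting from each row a multiple of the next one. -/
theorem det_sub_smul_succ {n : ℕ} (v : ℕ → Fin n → K) (hv : v n = 0) (c : ℕ → K) :
    Matrix.det (Matrix.of fun j : Fin n => v j - c j • v (j + 1)) =
      Matrix.det (Matrix.of fun j : Fin n => v j) := by
  cases n with
  | zero => rw [Matrix.det_isEmpty, Matrix.det_isEmpty]
  | succ n =>
    rw [← Matrix.det_submatrix_equiv_self Fin.revPerm,
      ← Matrix.det_submatrix_equiv_self Fin.revPerm (Matrix.of fun j : Fin (n + 1) => v j)]
    refine (Matrix.det_eq_of_forall_row_eq_smul_add_pred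
      (fun i : Fin n => c (Fin.rev i.succ)) ?_ ?_).symm
    · intro j
      simp [hv]
    · intro i j
      have h1 : ((Fin.rev i.succ : Fin (n + 1)) : ℕ) + 1 = (Fin.rev i.castSucc : Fin (n + 1)) := by
        simp only [Fin.val_rev, Fin.val_succ, Fin.val_castSucc]
        omega
      simp only [Matrix.submatrix_apply, Matrix.of_apply, Fin.revPerm_apply, Pi.sub_apply,
        Pi.smul_apply, smul_eq_mul, h1]
      ring

theorem det_sum_eq_sum_piFinset {n : ℕ} (s : Fin n → Finset ℕ) (a : Fin n → ℕ → K)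
    (g : ℕ → Fin n → K) :
    Matrix.det (Matrix.of fun j => ∑ b ∈ s j, a j b • g b) =
      ∑ b ∈ Fintype.piFinset s, (∏ j, a j (b j)) * Matrix.det (Matrix.of fun j => g (b j)) := by
  classical
  refine ((Matrix.detRowAlternating (R := K) (n := Fin n)).toMultilinearMap.map_sum_finset
    (fun j b => a j b • g b) s).trans ?_
  refine Finset.sum_congr rfl fun b _ => ?_
  exact (Matrix.detRowAlternating (R := K) (n := Fin n)).toMultilinearMap.map_smul_univ
    (fun j => a j (b j)) (fun j => g (b j))

open Classical in
/-- Summing a determinant in the shifted parts over the removals of a horizontal strip replaces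
each row by its convolution with a geometric sequence. -/
theorem sum_horizontal_strips {n N t : ℕ} {lam : YoungDiagram} (hlam : lam.rowLen n = 0)
    (htN : t < N) (hnt : 2 * n ≤ t + 2) (c : K) (g : ℕ → Fin n → K) :
    ∑ mu ∈ subdiagrams lam with IsStrip N t lam mu,
        c ^ (lam.card - mu.card) * Matrix.det (Matrix.of fun j : Fin n => g (shiftedPart n mu j)) =
      Matrix.det (Matrix.of fun j : Fin n => geomConv c g (shiftedPart n lam j)) := by
  rw [sum_subdiagrams_eq_sum_piFinset hlam _
    (fun j : Fin n => Ioc (shiftedPart n lam (j + 1)) (shiftedPart n lam j)) c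
    (fun b => Matrix.det (Matrix.of fun j => g (b j)))
    (fun mu h => isStrip_iff_of_lt hlam htN hnt h) ?_ (fun j a ha => (mem_Ioc.1 ha).2)]
  -- The sum over an interval is a difference of two convolutions; the subtracted one is a multiple
  -- of the next row.
  · rw [← det_sum_eq_sum_piFinset _ (fun j b => c ^ (shiftedPart n lam j - b)) g]
    rw [← det_sub_smul_succ (fun j => geomConv c g (shiftedPart n lam j)) (by
      simp [shiftedPart, hlam, geomConv])
      (fun j => c ^ (shiftedPart n lam j - shiftedPart n lam (j + 1)))]
    refine congrArg (fun M => Matrix.det (Matrix.of M)) (funext fun j => ?_)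
    exact sum_Ioc_eq_geomConv_sub c g (shiftedPart_lt lam (Nat.lt_succ_self _) j.2).le
  · intro b hb _
    have hb' := fun j => mem_Ioc.1 (Fintype.mem_piFinset.1 hb j)
    refine ⟨fun i j hij => ?_, fun j => Nat.zero_lt_of_lt (hb' j).1⟩
    refine (hb' j).2.trans_lt (lt_of_le_of_lt ?_ (hb' i).1)
    rcases Nat.lt_or_ge (i + 1) j with h | h
    · exact (shiftedPart_lt lam h j.2.le).le
    · rw [show (j : ℕ) = i + 1 by have := Fin.lt_def.1 hij; omega]

open Classical in
/-- Summing a determinant in the shifted parts over the removals of a vertical strip. The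
sequences obtained by lowering some parts by one that are not strictly decreasing, or that reach
zero, contribute nothing. -/
theorem sum_vertical_strips {n N t : ℕ} {lam : YoungDiagram} (hlam : lam.rowLen n = 0)
    (hNt : N ≤ t) (c : K) (g : ℕ → Fin n → K) (hg : g 0 = 0) :
    ∑ mu ∈ subdiagrams lam with IsStrip N t lam mu,
        c ^ (lam.card - mu.card) * Matrix.det (Matrix.of fun j : Fin n => g (shiftedPart n mu j)) =
      Matrix.det (Matrix.of fun j : Fin n =>
        g (shiftedPart n lam j) + c • g (shiftedPart n lam j - 1)) := by
  have hpos : ∀ j : Fin n, 0 < shiftedPart n lam j := by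
    intro j
    unfold shiftedPart
    omega
  rw [sum_subdiagrams_eq_sum_piFinset hlam _
    (fun j : Fin n => Icc (shiftedPart n lam j - 1) (shiftedPart n lam j)) c
    (fun b => Matrix.det (Matrix.of fun j => g (b j)))
    (fun mu h => isStrip_iff_of_le hlam hNt h) ?_ (fun j a ha => (mem_Icc.1 ha).2)]
  · rw [← det_sum_eq_sum_piFinset _ (fun j b => c ^ (shiftedPart n lam j - b)) g]
    refine congrArg (fun M => Matrix.det (Matrix.of M)) (funext fun j => ?_)
    obtain ⟨a, ha⟩ := Nat.exists_eq_succ_of_ne_zero (hpos j).ne'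
    have h1 : Icc a (a + 1) = {a, a + 1} := by
      ext i
      simp only [mem_Icc, mem_insert, mem_singleton]
      omega
    rw [ha, Nat.succ_sub_one, Nat.succ_eq_add_one, h1, Finset.sum_pair (by omega)]
    simp [add_comm]
  · intro b hb hdet
    have hb' := fun j => mem_Icc.1 (Fintype.mem_piFinset.1 hb j)
    refine ⟨fun i j hij => ?_, fun j => ?_⟩
    · have h1 := shiftedPart_lt lam (Fin.lt_def.1 hij) j.2.le
      have h2 := hb' i
      have h3 := hb' j
      refine lt_of_le_of_ne (by omega) fun h => hdet ?_
      exact Matrix.det_zero_of_row_eq hij.ne (congrArg g h.symm)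
    · refine Nat.pos_of_ne_zero fun h => hdet ?_
      refine Matrix.det_eq_zero_of_row_eq_zero j fun i => ?_
      rw [Matrix.of_apply, h, hg, Pi.zero_apply]

end Strips

/-! ### Symplectic tableaux and the Weyl character formula -/

section Symplectic

open Finset

variable {K : Type*} [CommRing K]

/-- The Vandermonde product of `z 0, …, z (n - 1)`. -/
def vandProd (n : ℕ) (z : ℕ → K) : K := ∏ i : Fin n, ∏ j : Fin n with i < j, (z i - z j)

theorem vandProd_succ (n : ℕ) (z : ℕ → K) :
    vandProd (n + 1) z = vandProd n z * ∏ i : Fin n, (z i - z n) := by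
  simp only [vandProd, Finset.prod_filter, Fin.prod_univ_castSucc, Fin.castSucc_lt_castSucc_iff,
    Fin.castSucc_lt_last, if_true, Fin.val_castSucc, Fin.val_last, lt_irrefl, if_false, mul_one,
    Finset.prod_mul_distrib]
  have : ∀ i : Fin n, ¬ Fin.last n < i.castSucc := fun i => (Fin.castSucc_lt_last i).not_gt
  simp [this]

/-- The Chebyshev-type polynomials with `chebU (x + x⁻¹) l * (x - x⁻¹) = x ^ l - x⁻¹ ^ l`. -/
def chebU (z : K) : ℕ → K
  | 0 => 0
  | 1 => 1
  | l + 2 => z * chebU z (l + 1) - chebU z l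

theorem mul_chebU {x x' : K} (h : x * x' = 1) (l : ℕ) :
    (x - x') * chebU (x + x') l = x ^ l - x' ^ l := by
  induction l using Nat.twoStepInduction with
  | zero => simp [chebU]
  | one => simp [chebU]
  | more l h1 h2 =>
    rw [chebU, mul_sub, mul_left_comm, h1, h2]
    linear_combination (x ^ l - x' ^ l) * h

theorem geomConv_geomConv {n : ℕ} {c d : K} (h : c * d = 1) (g : ℕ → Fin n → K) (l : ℕ) :
    geomConv d (geomConv c g) (l + 2) =
      (c + d) • geomConv d (geomConv c g) (l + 1) - geomConv d (geomConv c g) l + g (l + 2) := by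
  funext i
  simp only [geomConv, Pi.add_apply, Pi.smul_apply, Pi.sub_apply, smul_eq_mul]
  linear_combination (-geomConv d (geomConv c g) l i) * h

/-- The rows of the matrix of size `n + 1` whose determinant is a symplectic numerator in `n`
variables: the last coordinate forces the last shifted part to be `1`. -/
def symplecticRow (n : ℕ) (z : ℕ → K) (l : ℕ) : Fin (n + 1) → K :=
  Fin.snoc (fun i : Fin n => chebU (z i) (l - 1)) (if l = 1 then 1 else 0)

theorem symplecticRow_castSucc (n : ℕ) (z : ℕ → K) (l : ℕ) (i : Fin n) :
    symplecticRow n z l i.castSucc = chebU (z i) (l - 1) := by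
  simp [symplecticRow]

theorem symplecticRow_last (n : ℕ) (z : ℕ → K) (l : ℕ) :
    symplecticRow n z l (Fin.last n) = if l = 1 then 1 else 0 := by
  simp [symplecticRow]

theorem geomConv_geomConv_last {n : ℕ} {c d : K} (h : c * d = 1) (z : ℕ → K) (l : ℕ) :
    geomConv d (geomConv c (symplecticRow n z)) l (Fin.last n) = chebU (c + d) l := by
  induction l using Nat.twoStepInduction with
  | zero => simp [geomConv, chebU]
  | one => simp [geomConv, chebU, symplecticRow_last]
  | more l h1 h2 =>
    rw [geomConv_geomConv h]
    simp only [Pi.add_apply, Pi.smul_apply, Pi.sub_apply, smul_eq_mul, h1, h2, symplecticRow_last,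
      chebU]
    simp

theorem geomConv_geomConv_castSucc {n : ℕ} {c d : K} (h : c * d = 1) (z : ℕ → K) (l : ℕ)
    (i : Fin n) :
    (z i - (c + d)) * geomConv d (geomConv c (symplecticRow n z)) l i.castSucc =
      chebU (z i) l - chebU (c + d) l := by
  induction l using Nat.twoStepInduction with
  | zero => simp [geomConv, chebU]
  | one => simp [geomConv, chebU, symplecticRow_castSucc]
  | more l h1 h2 =>
    rw [geomConv_geomConv h]
    simp only [Pi.add_apply, Pi.smul_apply, Pi.sub_apply, smul_eq_mul, symplecticRow_castSucc,
      chebU, show l + 2 - 1 = l + 1 from rfl]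
    linear_combination (c + d) * h2 - h1

/-- Subtracting the last column of a symplectic numerator from the others makes the differences
`z i - z n` factor out. -/
theorem det_chebU_succ {n : ℕ} {c d : K} (h : c * d = 1) (z : ℕ → K) (hz : z n = c + d)
    (L : Fin (n + 1) → ℕ) :
    Matrix.det (Matrix.of fun j i : Fin (n + 1) => chebU (z i) (L j)) =
      (∏ i : Fin n, (z i - z n)) *
        Matrix.det (Matrix.of fun j => geomConv d (geomConv c (symplecticRow n z)) (L j)) := by
  have h1 : ∏ i : Fin n, (z i - z n) =
      ∏ i, (Fin.snoc (fun i : Fin n => z i - z n) 1 : Fin (n + 1) → K) i := by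
    rw [Fin.prod_univ_castSucc]
    simp
  rw [h1, ← Matrix.det_mul_row, ← Matrix.det_transpose, ← Matrix.det_transpose (Matrix.of _)]
  refine Matrix.det_eq_of_forall_row_eq_smul_add_const
    (Fin.snoc (fun _ : Fin n => 1) 0 : Fin (n + 1) → K) (Fin.last n) (by simp) ?_
  intro i j
  simp only [Matrix.transpose_apply, Matrix.of_apply, geomConv_geomConv_last h, Fin.snoc_last,
    one_mul]
  refine Fin.lastCases ?_ (fun i => ?_) i
  · simp [geomConv_geomConv_last h, hz]
  · simp only [Fin.snoc_castSucc, Fin.val_castSucc, hz, geomConv_geomConv_castSucc h]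
    ring

/-- A symplectic numerator in `n` variables as a determinant of size `n + 1`. For a shape with
`n + 1` rows both sides vanish, so the formula extends to all shapes summed over in the branching
from `n + 1` to `n` variables. -/
theorem det_symplecticRow {n N : ℕ} (hN : 2 * n ≤ N) (w z : ℕ → K) (D : K)
    (ih : ∀ mu : YoungDiagram, mu.rowLen n = 0 → D * rankSum N (2 * n) w mu =
      Matrix.det (Matrix.of fun j i : Fin n => chebU (z i) (shiftedPart n mu j)))
    (mu : YoungDiagram) :
    D * rankSum N (2 * n) w mu =
      Matrix.det (Matrix.of fun j : Fin (n + 1) =>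
        symplecticRow n z (shiftedPart (n + 1) mu j)) := by
  by_cases h : mu.rowLen n = 0
  · rw [ih mu h, Matrix.det_succ_row _ (Fin.last n), Fin.sum_univ_castSucc,
      Finset.sum_eq_zero, zero_add]
    · have h1 : shiftedPart (n + 1) mu n = 1 := by simp [shiftedPart, h]
      simp only [Fin.val_last, Matrix.of_apply, h1, symplecticRow_last, if_true, mul_one,
        Even.neg_one_pow (Even.add_self n), one_mul, Fin.succAbove_last]
      congr 1
      ext j i
      simp only [Matrix.submatrix_apply, Matrix.of_apply, symplecticRow_castSucc,
        Fin.val_castSucc, shiftedPart]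
      congr 1
      omega
    · intro i _
      simp [shiftedPart, h, symplecticRow_castSucc, chebU]
  · rw [rankSum_eq_zero w hN le_rfl h, mul_zero, eq_comm]
    refine Matrix.det_eq_zero_of_column_eq_zero (Fin.last n) fun j => ?_
    have h1 := mu.rowLen_anti j n (Nat.lt_succ_iff.1 j.2)
    rw [Matrix.of_apply, symplecticRow_last, if_neg]
    unfold shiftedPart
    omega

/-- Adding a letter: a common factor `D` passes through the sum over horizontal strips. -/
theorem mul_rankSum_succ_horizontal {n N t : ℕ} (htN : t < N) (hnt : 2 * n ≤ t + 2) (w : ℕ → K)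
    (D : K) (g : ℕ → Fin n → K)
    (ih : ∀ mu : YoungDiagram, mu.rowLen n = 0 → D * rankSum N t w mu =
      Matrix.det (Matrix.of fun j : Fin n => g (shiftedPart n mu j)))
    (lam : YoungDiagram) (hlam : lam.rowLen n = 0) :
    D * rankSum N (t + 1) w lam =
      Matrix.det (Matrix.of fun j : Fin n => geomConv (w t) g (shiftedPart n lam j)) := by
  classical
  rw [rankSum_succ, ← sum_horizontal_strips hlam htN hnt, Finset.mul_sum]
  refine Finset.sum_congr rfl fun mu hmu => ?_
  have hle := mem_subdiagrams.1 (mem_filter.1 hmu).1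
  rw [mul_left_comm, ih mu (Nat.eq_zero_of_le_zero
    ((YoungDiagram.le_iff_rowLen.1 hle n).trans hlam.le))]

/-- The sum over King's symplectic tableaux is given by the Weyl character formula. -/
theorem vandProd_mul_rankSum (n : ℕ) {N : ℕ} (hN : 2 * n ≤ N) (w z : ℕ → K)
    (hw : ∀ i < n, w (2 * i) * w (2 * i + 1) = 1) (hz : ∀ i < n, z i = w (2 * i) + w (2 * i + 1))
    (lam : YoungDiagram) (hlam : lam.rowLen n = 0) :
    vandProd n z * rankSum N (2 * n) w lam =
      Matrix.det (Matrix.of fun j i : Fin n => chebU (z i) (shiftedPart n lam j)) := by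
  induction n generalizing lam with
  | zero =>
    have : lam = ⊥ := le_bot_iff.1 (YoungDiagram.le_iff_rowLen.2 fun i => by
      rw [YoungDiagram.rowLen_eq_zero_of_le hlam (Nat.zero_le i)]
      exact Nat.zero_le _)
    rw [this, rankSum_bot, Matrix.det_isEmpty]
    simp [vandProd]
  | succ n ih =>
    have h0 := det_symplecticRow (by omega) w z (vandProd n z)
      (ih (by omega) (fun i hi => hw i (by omega)) (fun i hi => hz i (by omega)))
    have h1 := mul_rankSum_succ_horizontal (n := n + 1) (t := 2 * n) (by omega) (by omega) w
      (vandProd n z) _ fun mu _ => h0 mu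
    have h2 := mul_rankSum_succ_horizontal (n := n + 1) (t := 2 * n + 1) (by omega) (by omega) w
      (vandProd n z) _ h1 lam hlam
    rw [vandProd_succ, mul_right_comm, show 2 * (n + 1) = 2 * n + 1 + 1 by ring, h2,
      det_chebU_succ (hw n (by omega)) z (hz n (by omega)), mul_comm]

end Symplectic

/-! ### The orthosymplectic Schur function as a determinant of size `n` -/

section Orthosymplectic

open Finset

variable {K : Type*} [CommRing K]

/-- The coefficient of `t ^ c` in `(1 + y 0 * t) ⋯ (1 + y (s - 1) * t) / (1 - x * t)`. -/
def superComplete (y : ℕ → K) (x : K) : ℕ → ℕ → K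
  | 0, c => x ^ c
  | _ + 1, 0 => 1
  | s + 1, c + 1 => superComplete y x s (c + 1) + y s * superComplete y x s c

theorem superComplete_zero (y : ℕ → K) (x : K) (s : ℕ) : superComplete y x s 0 = 1 := by
  cases s <;> simp [superComplete]

theorem superComplete_succ_right (y : ℕ → K) (x : K) (s c : ℕ) :
    superComplete y x s (c + 1) = x * superComplete y x s c + superComplete y 0 s (c + 1) := by
  induction s generalizing c with
  | zero => simp [superComplete, pow_succ']
  | succ s ih =>
    cases c with
    | zero =>
      simp only [superComplete, ih 0, superComplete_zero]
      ring
    | succ c =>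
      simp only [superComplete]
      rw [ih (c + 1), ih c]
      ring

theorem superComplete_of_le (y : ℕ → K) (x : K) {s c : ℕ} (h : s ≤ c) :
    superComplete y x s c = x ^ (c - s) * ∏ q ∈ range s, (x + y q) := by
  induction s generalizing c with
  | zero => simp [superComplete]
  | succ s ih =>
    obtain ⟨c, rfl⟩ := Nat.exists_eq_add_of_le' (Nat.one_le_of_lt h)
    rw [superComplete, ih (by omega), ih (by omega), Finset.prod_range_succ,
      show c + 1 - s = c - s + 1 by omega, show c + 1 - (s + 1) = c - s by omega]
    ring

/-- Horner's scheme for the divided difference of `superComplete y · s M`. -/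
theorem sub_mul_sum_superComplete (y : ℕ → K) (x z : K) (s M : ℕ) :
    (x - z) * ∑ c ∈ range M, z ^ (M - 1 - c) * superComplete y x s c =
      superComplete y x s M - superComplete y z s M := by
  induction M with
  | zero => simp [superComplete_zero]
  | succ M ih =>
    have h1 : ∀ c ∈ range M, z ^ (M + 1 - 1 - c) * superComplete y x s c =
        z * (z ^ (M - 1 - c) * superComplete y x s c) := by
      intro c hc
      have := mem_range.1 hc
      rw [show M + 1 - 1 - c = M - 1 - c + 1 by omega]
      ring
    rw [Finset.sum_range_succ, Finset.sum_congr rfl h1, ← Finset.mul_sum,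
      superComplete_succ_right y x, superComplete_succ_right y z, Nat.add_sub_cancel,
      Nat.sub_self]
    linear_combination z * ih

/-- The entry at the variable `x`, with inverse `x'`, of the orthosymplectic numerators with `s`
odd variables. -/
def ospEntry (y : ℕ → K) (x x' : K) (s l : ℕ) : K :=
  superComplete y x s l - superComplete y x' s l

theorem ospEntry_zero (y : ℕ → K) (x x' : K) (s : ℕ) : ospEntry y x x' s 0 = 0 := by
  simp [ospEntry, superComplete_zero]

/-- The entries start from `x ^ l - x' ^ l`, and each primed letter contributes one step
`A_l ↦ A_l + y A_(l - 1)` of the recursion for `superComplete`; at `l = 1` the second term is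
absent because `A_0 = 0`. -/
theorem mul_rankSum_eq_det_ospEntry (n : ℕ) (w : ℕ → K)
    (hw : ∀ i < n, w (2 * i) * w (2 * i + 1) = 1) (s : ℕ)
    (lam : YoungDiagram) (hlam : lam.rowLen n = 0) :
    (vandProd n fun i => w (2 * i) + w (2 * i + 1)) * (∏ i : Fin n, (w (2 * i) - w (2 * i + 1))) *
        rankSum (2 * n) (2 * n + s) w lam =
      Matrix.det (Matrix.of fun j i : Fin n =>
        ospEntry (fun q => w (2 * n + q)) (w (2 * i)) (w (2 * i + 1)) s (shiftedPart n lam j)) := by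
  induction s generalizing lam with
  | zero =>
    rw [mul_right_comm, Nat.add_zero,
      vandProd_mul_rankSum n le_rfl w _ hw (fun _ _ => rfl) lam hlam, mul_comm,
      ← Matrix.det_mul_row]
    congr 1
    ext j i
    simp only [Matrix.of_apply, ospEntry, superComplete]
    exact mul_chebU (hw i i.2) _
  | succ s ih =>
    classical
    rw [← Nat.add_assoc, rankSum_succ, Finset.mul_sum]
    have h1 := sum_vertical_strips hlam (Nat.le_add_right (2 * n) s) (w (2 * n + s))
      (fun l (i : Fin n) =>
        ospEntry (fun q => w (2 * n + q)) (w (2 * i)) (w (2 * i + 1)) s l)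
      (funext fun i => ospEntry_zero _ _ _ _)
    refine (Finset.sum_congr rfl fun mu hmu => ?_).trans (h1.trans ?_)
    · have hle := mem_subdiagrams.1 (mem_filter.1 hmu).1
      rw [mul_left_comm, ih mu (Nat.eq_zero_of_le_zero
        ((YoungDiagram.le_iff_rowLen.1 hle n).trans hlam.le))]
    · congr 1
      ext j i
      obtain ⟨a, ha⟩ : ∃ a, shiftedPart n lam j = a + 1 :=
        Nat.exists_eq_succ_of_ne_zero (by unfold shiftedPart; omega)
      simp only [Matrix.of_apply, Pi.add_apply, Pi.smul_apply, smul_eq_mul, ha,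
        Nat.add_sub_cancel, ospEntry, superComplete]
      ring

end Orthosymplectic

/-! ### Products of signs over pairs -/

section SignOfSplitting

open Finset

/-- The sign of a comparison: `1` for `a < b`, `-1` for `b < a`, and `0` for `a = b`. -/
def cmpSign (K : Type*) [CommRing K] (a b : ℕ) : K := if a < b then 1 else if b < a then -1 else 0

variable {K : Type*} [CommRing K]

theorem cmpSign_of_lt {a b : ℕ} (h : a < b) : cmpSign K a b = 1 := if_pos h

theorem cmpSign_of_gt {a b : ℕ} (h : b < a) : cmpSign K a b = -1 := by
  rw [cmpSign, if_neg h.not_gt, if_pos h]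

theorem cmpSign_antisymm (a b : ℕ) : cmpSign K a b = -cmpSign K b a := by
  rcases lt_trichotomy a b with h | rfl | h
  · rw [cmpSign_of_lt h, cmpSign_of_gt h, neg_neg]
  · simp [cmpSign]
  · rw [cmpSign_of_lt h, cmpSign_of_gt h]

/-- A product over the pairs `i < j` of a concatenation of two blocks. -/
theorem prod_pairs_sum {N a b : ℕ} (h : N = a + b) (F : Fin a ⊕ Fin b → Fin a ⊕ Fin b → K) :
    ∏ j : Fin N, ∏ i ∈ Iio j,
        F (finSumFinEquiv.symm (Fin.cast h i)) (finSumFinEquiv.symm (Fin.cast h j)) =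
      (∏ j : Fin a, ∏ i ∈ Iio j, F (Sum.inl i) (Sum.inl j)) *
        ((∏ j : Fin b, ∏ i : Fin a, F (Sum.inl i) (Sum.inr j)) *
          ∏ j : Fin b, ∏ i ∈ Iio j, F (Sum.inr i) (Sum.inr j)) := by
  subst h
  have hIio : ∀ {k : ℕ} (j : Fin k) (G : Fin k → K),
      ∏ i ∈ Iio j, G i = ∏ i, if i < j then G i else 1 := by
    intro k j G
    rw [← Finset.prod_filter]
    congr 1
    ext i
    simp
  have h1 : ∀ (i : Fin b) (j : Fin a), ¬ Fin.natAdd a i < Fin.castAdd b j := by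
    intro i j
    simp only [Fin.lt_def, Fin.val_natAdd, Fin.val_castAdd]
    omega
  have h2 : ∀ (i : Fin a) (j : Fin b), Fin.castAdd b i < Fin.natAdd a j := by
    intro i j
    simp only [Fin.lt_def, Fin.val_natAdd, Fin.val_castAdd]
    omega
  have h3 : ∀ i j : Fin a, Fin.castAdd b i < Fin.castAdd b j ↔ i < j := fun i j => Iff.rfl
  have h4 : ∀ i j : Fin b, Fin.natAdd a i < Fin.natAdd a j ↔ i < j := by
    intro i j
    rw [Fin.lt_def, Fin.lt_def, Fin.val_natAdd, Fin.val_natAdd, Nat.add_lt_add_iff_left]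
  simp only [hIio, Fin.cast_refl, id_eq, Fin.prod_univ_add, finSumFinEquiv_symm_apply_castAdd,
    finSumFinEquiv_symm_apply_natAdd, h1, h2, h3, h4, if_true, if_false, Finset.prod_const_one,
    Finset.prod_mul_distrib]
  rw [one_mul, mul_assoc]

theorem prod_cmpSign_increasing {k : ℕ} (v : Fin k → ℕ) (hv : StrictMono v) :
    ∏ j : Fin k, ∏ i ∈ Iio j, cmpSign K (v i) (v j) = 1 :=
  Finset.prod_eq_one fun _ _ => Finset.prod_eq_one fun _ hi => cmpSign_of_lt (hv (mem_Iio.1 hi))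

theorem prod_cmpSign_decreasing {k : ℕ} (v : Fin k → ℕ) (hv : StrictAnti v) :
    ∏ j : Fin k, ∏ i ∈ Iio j, cmpSign K (v i) (v j) = ∏ j ∈ range k, (-1) ^ j := by
  rw [← Fin.prod_univ_eq_prod_range]
  refine Finset.prod_congr rfl fun j _ => ?_
  rw [Finset.prod_congr rfl fun i hi => cmpSign_of_gt (hv (mem_Iio.1 hi)), Finset.prod_const,
    Fin.card_Iio]

theorem prod_ite_lt (p a : ℕ) :
    ∏ i : Fin p, (if (i : ℕ) < a then (-1 : K) else 1) = (-1) ^ min p a := by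
  induction p with
  | zero => simp
  | succ p ih =>
    rw [Fin.prod_univ_castSucc]
    simp only [Fin.val_castSucc, Fin.val_last, ih]
    split_ifs with h
    · rw [min_eq_left h.le, min_eq_left h, pow_succ]
    · rw [min_eq_right (not_lt.1 h), min_eq_right (by omega), mul_one]

end SignOfSplitting

/-! ### Shifted parts, their complement, and the core of the block matrix -/

section Complement

open Finset

/-- The elements, in increasing order, of the complement of the set of shifted parts in the
positive integers; they are determined by the conjugate partition.
The subtraction is not truncated if `lam` has at most `n` rows. -/
noncomputable def complPart (n : ℕ) (lam : YoungDiagram) (i : ℕ) : ℕ := n + i + 1 - lam.colLen i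

variable {n : ℕ} {lam : YoungDiagram}

theorem colLen_le (h : lam.rowLen n = 0) (i : ℕ) : lam.colLen i ≤ n := by
  by_contra! hi
  have := YoungDiagram.mem_iff_lt_rowLen.1 (YoungDiagram.mem_iff_lt_colLen.2 hi)
  omega

theorem complPart_strictMono (h : lam.rowLen n = 0) : StrictMono (complPart n lam) := by
  intro i j hij
  have h1 := lam.colLen_anti i j hij.le
  have h2 := colLen_le h i
  unfold complPart
  omega

theorem complPart_lt_shiftedPart (h : lam.rowLen n = 0) {i j : ℕ} (hij : i < lam.rowLen j) :
    complPart n lam i < shiftedPart n lam j := by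
  have h1 := YoungDiagram.mem_iff_lt_colLen.1 (YoungDiagram.mem_iff_lt_rowLen.2 hij)
  have h2 := colLen_le h i
  unfold complPart shiftedPart
  omega

theorem shiftedPart_lt_complPart (h : lam.rowLen n = 0) {i j : ℕ} (hj : j < n)
    (hij : ¬ i < lam.rowLen j) : shiftedPart n lam j < complPart n lam i := by
  have h1 : ¬ j < lam.colLen i := fun h1 =>
    hij (YoungDiagram.mem_iff_lt_rowLen.1 (YoungDiagram.mem_iff_lt_colLen.2 h1))
  have h2 := colLen_le h i
  unfold complPart shiftedPart
  omega

/-- The data of the block matrix: `r` is the number of shifted parts exceeding `m`, and `p` is the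
number of positive integers up to `m` that are not shifted parts. -/
structure IsSplitting (n m r p : ℕ) (lam : YoungDiagram) : Prop where
  rowLen_eq : lam.rowLen n = 0
  le : r ≤ n
  size : n + p = m + r
  gt : ∀ j < r, m < shiftedPart n lam j
  shiftedPart_le : ∀ j < n, r ≤ j → shiftedPart n lam j ≤ m

variable {m r p : ℕ}

theorem IsSplitting.complPart_le (h : IsSplitting n m r p lam) {i : ℕ} (hi : i < p) :
    complPart n lam i ≤ m := by
  have h1 := h.size
  have h2 : r ≤ lam.colLen i := by
    rcases Nat.eq_zero_or_pos r with h0 | h0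
    · omega
    · have h3 := h.gt (r - 1) (by omega)
      have h4 := h.le
      unfold shiftedPart at h3
      have := YoungDiagram.mem_iff_lt_colLen.1
        (YoungDiagram.mem_iff_lt_rowLen.2 (show i < lam.rowLen (r - 1) by omega))
      omega
  unfold complPart
  omega

/-- The value in the positive integers attached to a column of the block matrix. -/
noncomputable def colValue (n m r : ℕ) (lam : YoungDiagram) : Fin m ⊕ Fin r → ℕ
  | Sum.inl c => c + 1
  | Sum.inr j => shiftedPart n lam j

/-- The values of the columns, listed in the order in which the determinant becomes block
triangular: the shifted parts, and then their complement. -/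
noncomputable def rowValue (n p : ℕ) (lam : YoungDiagram) : Fin n ⊕ Fin p → ℕ
  | Sum.inl j => shiftedPart n lam j
  | Sum.inr i => complPart n lam i

theorem IsSplitting.shiftedPart_ne_complPart (h : IsSplitting n m r p lam) (j : Fin n) (i : ℕ) :
    shiftedPart n lam j ≠ complPart n lam i := by
  by_cases hij : i < lam.rowLen j
  · exact (complPart_lt_shiftedPart h.rowLen_eq hij).ne'
  · exact (shiftedPart_lt_complPart h.rowLen_eq j.2 hij).ne

theorem IsSplitting.rowValue_injective (h : IsSplitting n m r p lam) :
    Function.Injective (rowValue n p lam) := by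
  rintro (i | i) (j | j) hij <;> simp only [rowValue] at hij
  · rcases lt_trichotomy i j with h1 | rfl | h1
    · exact absurd hij (shiftedPart_lt lam h1 j.2.le).ne'
    · rfl
    · exact absurd hij (shiftedPart_lt lam h1 i.2.le).ne
  · exact absurd hij (h.shiftedPart_ne_complPart _ _)
  · exact absurd hij.symm (h.shiftedPart_ne_complPart _ _)
  · rw [Fin.ext ((complPart_strictMono h.rowLen_eq).injective hij)]

theorem IsSplitting.exists_equiv (h : IsSplitting n m r p lam) :
    ∃ e : Fin n ⊕ Fin p ≃ Fin m ⊕ Fin r, ∀ a, colValue n m r lam (e a) = rowValue n p lam a := by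
  have h1 : ∀ a, ∃ b, colValue n m r lam b = rowValue n p lam a := by
    have small : ∀ v, 0 < v → v ≤ m → ∃ b, colValue n m r lam b = v := fun v h0 hv =>
      ⟨Sum.inl ⟨v - 1, by omega⟩, by simp only [colValue]; omega⟩
    rintro (j | i)
    · by_cases hj : (j : ℕ) < r
      · exact ⟨Sum.inr ⟨j, hj⟩, rfl⟩
      · refine small _ ?_ (h.shiftedPart_le j j.2 (not_lt.1 hj))
        simp only [rowValue, shiftedPart]
        omega
    · refine small _ ?_ (h.complPart_le i.2)
      have := colLen_le h.rowLen_eq i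
      simp only [rowValue, complPart]
      omega
  choose f hf using h1
  have hinj : Function.Injective f := fun a b hab => h.rowValue_injective (by
    rw [← hf, ← hf, hab])
  have hcard : Fintype.card (Fin n ⊕ Fin p) = Fintype.card (Fin m ⊕ Fin r) := by
    simp [h.size]
  exact ⟨Equiv.ofBijective f ((Fintype.bijective_iff_injective_and_card f).2 ⟨hinj, hcard⟩), hf⟩

variable {K : Type*} [CommRing K]

theorem IsSplitting.prod_cmpSign_colValue (h : IsSplitting n m r p lam) :
    ∏ j : Fin (n + p), ∏ i ∈ Iio j,
        cmpSign K (colValue n m r lam (finSumFinEquiv.symm (Fin.cast h.size i)))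
          (colValue n m r lam (finSumFinEquiv.symm (Fin.cast h.size j))) =
      ∏ j ∈ range r, (-1) ^ j := by
  rw [prod_pairs_sum h.size fun a b => cmpSign K (colValue n m r lam a) (colValue n m r lam b)]
  simp only [colValue]
  rw [prod_cmpSign_increasing (fun j : Fin m => (j : ℕ) + 1) fun i j hij => Nat.succ_lt_succ hij,
    prod_cmpSign_decreasing (fun j : Fin r => shiftedPart n lam j)
      fun i j hij => shiftedPart_lt lam hij (j.2.le.trans h.le),
    Finset.prod_eq_one, one_mul, one_mul]
  intro j _
  refine Finset.prod_eq_one fun i _ => cmpSign_of_lt ?_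
  have := h.gt j j.2
  omega

theorem IsSplitting.prod_cmpSign_rowValue (h : IsSplitting n m r p lam) :
    ∏ j : Fin (n + p), ∏ i ∈ Iio j,
        cmpSign K (rowValue n p lam (finSumFinEquiv.symm i))
          (rowValue n p lam (finSumFinEquiv.symm j)) =
      ∏ j ∈ range n, (-1) ^ (j + min p (lam.rowLen j)) := by
  refine (prod_pairs_sum rfl fun a b =>
    cmpSign K (rowValue n p lam a) (rowValue n p lam b)).trans ?_
  simp only [rowValue]
  rw [prod_cmpSign_increasing (fun j : Fin p => complPart n lam j)
      fun i j hij => complPart_strictMono h.rowLen_eq hij,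
    prod_cmpSign_decreasing (fun j : Fin n => shiftedPart n lam j)
      fun i j hij => shiftedPart_lt lam hij j.2.le, mul_one, Finset.prod_comm]
  simp only [pow_add, Finset.prod_mul_distrib]
  congr 1
  rw [← Fin.prod_univ_eq_prod_range]
  refine Finset.prod_congr rfl fun j _ => ?_
  rw [← prod_ite_lt]
  refine Finset.prod_congr rfl fun i _ => ?_
  split_ifs with hij
  · exact cmpSign_of_gt (complPart_lt_shiftedPart h.rowLen_eq hij)
  · exact cmpSign_of_lt (shiftedPart_lt_complPart h.rowLen_eq j.2 hij)

/-- The total sign: that of the permutation of the columns, and those of the columns with values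
at most `m`. -/
theorem IsSplitting.prod_signs (h : IsSplitting n m r p lam) :
    (∏ j ∈ range r, (-1 : K) ^ j) * (∏ j ∈ range n, (-1) ^ (j + min p (lam.rowLen j))) *
        (∏ j ∈ range n, (-1) ^ (m - shiftedPart n lam j)) = (-1) ^ (m * n + n + r) := by
  have hsize := h.size
  obtain ⟨s, rfl⟩ := Nat.exists_eq_add_of_le h.le
  obtain rfl : m = p + s := by omega
  have h1 : ∀ j ∈ range r, (-1 : K) ^ j * ((-1) ^ (j + min p (lam.rowLen j)) *
      (-1) ^ (p + s - shiftedPart (r + s) lam j)) = (-1) ^ p := by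
    intro j hj
    have h2 := h.gt j (mem_range.1 hj)
    have h3 := h.gt (r - 1) (by have := mem_range.1 hj; omega)
    have h4 := lam.rowLen_anti j (r - 1) (by have := mem_range.1 hj; omega)
    have h5 := mem_range.1 hj
    unfold shiftedPart at h3
    rw [Nat.sub_eq_zero_of_le h2.le, min_eq_left (by omega), pow_zero, mul_one, pow_add,
      ← mul_assoc, ← pow_add, Even.neg_one_pow (Even.add_self j), one_mul]
  have h2 : ∀ j ∈ Ico r (r + s), (-1 : K) ^ (j + min p (lam.rowLen j)) *
      (-1) ^ (p + s - shiftedPart (r + s) lam j) = (-1) ^ (p + r) := by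
    intro j hj
    obtain ⟨h3, h4⟩ := mem_Ico.1 hj
    have h5 := h.shiftedPart_le j h4 h3
    have h6 := h.shiftedPart_le r (by omega) le_rfl
    have h7 := lam.rowLen_anti r j h3
    unfold shiftedPart at h5 h6 ⊢
    rw [← pow_add, min_eq_right (by omega)]
    refine neg_one_pow_congr ?_
    have h8 : j + lam.rowLen j + (p + s - (lam.rowLen j + (r + s - j))) + 2 * r =
      p + r + 2 * j := by omega
    simp only [Nat.even_iff]
    omega
  rw [mul_assoc, ← Finset.prod_mul_distrib, ← Finset.prod_range_mul_prod_Ico _ h.le, ← mul_assoc,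
    ← Finset.prod_mul_distrib, Finset.prod_congr rfl h1, Finset.prod_congr rfl h2,
    Finset.prod_const, Finset.prod_const, card_range, Nat.card_Ico, Nat.add_sub_cancel_left,
    ← pow_mul, ← pow_mul, ← pow_add]
  obtain ⟨t, ht⟩ := (Nat.even_mul_succ_self s).exists_two_nsmul _
  refine neg_one_pow_congr ?_
  have h3 : (p + s) * (r + s) + (r + s) + r = p * r + (p + r) * s + 2 * (t + r) := by
    rw [smul_eq_mul] at ht
    linear_combination ht
  rw [h3, Nat.even_add (m := p * r + (p + r) * s)]
  simp

/-- The block matrix without the factors that depend on its rows in the upper half, and without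
the Vandermonde matrix of the variables `y`. -/
noncomputable def coreMatrix (n m r p : ℕ) (lam : YoungDiagram) (a : Fin n → ℕ → K) :
    Matrix (Fin n ⊕ Fin p) (Fin m ⊕ Fin r) K :=
  Matrix.fromBlocks (Matrix.of fun i c => (-1) ^ (m - ((c : ℕ) + 1)) * a i (c + 1))
    (Matrix.of fun i j => a i (shiftedPart n lam j))
    (Matrix.of fun i c => if (c : ℕ) + 1 = complPart n lam i then 1 else 0) 0

theorem IsSplitting.coreMatrix_inl (h : IsSplitting n m r p lam) (a : Fin n → ℕ → K) (i : Fin n)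
    (b : Fin m ⊕ Fin r) : coreMatrix n m r p lam a (Sum.inl i) b =
      (-1) ^ (m - colValue n m r lam b) * a i (colValue n m r lam b) := by
  rcases b with c | j
  · rfl
  -- The truncated difference `m - shiftedPart n lam j` is zero here.
  · simp [coreMatrix, colValue, Nat.sub_eq_zero_of_le (h.gt j j.2).le]

theorem IsSplitting.coreMatrix_inr (h : IsSplitting n m r p lam) (a : Fin n → ℕ → K) (i : Fin p)
    (b : Fin m ⊕ Fin r) : coreMatrix n m r p lam a (Sum.inr i) b =
      if colValue n m r lam b = complPart n lam i then 1 else 0 := by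
  rcases b with c | j
  · rfl
  · have h1 := h.gt j j.2
    have h2 := h.complPart_le i.2
    exact (if_neg (show ¬ shiftedPart n lam j = complPart n lam i by omega)).symm

/-- The rows below carry the unit vectors of the columns that are not shifted parts, so that up to
sign the determinant is the one formed by the columns that are. -/
theorem IsSplitting.det_coreMatrix (h : IsSplitting n m r p lam) (a : Fin n → ℕ → K) :
    ((coreMatrix n m r p lam a).submatrix (fun s : Fin (n + p) => finSumFinEquiv.symm s)
        (fun s : Fin (n + p) => finSumFinEquiv.symm (Fin.cast h.size s))).det =
      (-1) ^ (m * n + n + r) *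
        Matrix.det (Matrix.of fun j i : Fin n => a i (shiftedPart n lam j)) := by
  obtain ⟨τ, hτ⟩ := h.exists_equiv
  let e : Fin (n + p) ≃ Fin n ⊕ Fin p := finSumFinEquiv.symm
  let f : Fin (n + p) ≃ Fin m ⊕ Fin r := (finCongr h.size).trans finSumFinEquiv.symm
  let σ : Equiv.Perm (Fin (n + p)) := (f.trans τ.symm).trans e.symm
  have hσ : ∀ s, rowValue n p lam (e (σ s)) = colValue n m r lam (f s) := by
    intro s
    rw [← hτ]
    simp [σ]
  -- `σ` rearranges the values of the columns, so it accounts for the difference in inversions.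
  have hsign : (Equiv.Perm.sign σ : K) *
      ∏ j ∈ range n, (-1) ^ (j + min p (lam.rowLen j)) = ∏ j ∈ range r, (-1) ^ j := by
    have h1 := σ.prod_Iio_comp_eq_sign_mul_prod
      (f := fun i j => cmpSign K (rowValue n p lam (e i)) (rowValue n p lam (e j)))
      fun i j => cmpSign_antisymm _ _
    simp only [hσ] at h1
    rw [← h.prod_cmpSign_rowValue, ← h.prod_cmpSign_colValue]
    exact h1.symm
  have hmat : (coreMatrix n m r p lam a).submatrix id τ =
      Matrix.fromBlocks
        (Matrix.of fun i j : Fin n =>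
          (-1) ^ (m - shiftedPart n lam j) * a i (shiftedPart n lam j))
        (Matrix.of fun i (j : Fin p) =>
          (-1) ^ (m - complPart n lam j) * a i (complPart n lam j)) 0 1 := by
    ext (i | i) (j | j)
    · simp [h.coreMatrix_inl, hτ, rowValue]
    · simp [h.coreMatrix_inl, hτ, rowValue]
    · simp [h.coreMatrix_inr, hτ, rowValue, h.shiftedPart_ne_complPart]
    · simp [h.coreMatrix_inr, hτ, rowValue, (complPart_strictMono h.rowLen_eq).injective.eq_iff,
        Matrix.one_apply, Fin.ext_iff, eq_comm]
  have hsub : (coreMatrix n m r p lam a).submatrix e f =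
      (((coreMatrix n m r p lam a).submatrix id τ).submatrix e e).submatrix id σ := by
    ext s t
    simp [σ]
  have hdet : (∏ j ∈ range n, (-1 : K) ^ (m - shiftedPart n lam j)) *
      Matrix.det (Matrix.of fun j i : Fin n => a i (shiftedPart n lam j)) =
      Matrix.det (Matrix.of fun i j : Fin n =>
          (-1) ^ (m - shiftedPart n lam j) * a i (shiftedPart n lam j)) := by
    rw [← Fin.prod_univ_eq_prod_range (fun j => (-1 : K) ^ (m - shiftedPart n lam j)),
      ← Matrix.det_transpose (Matrix.of fun j i : Fin n => a i (shiftedPart n lam j)),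
      ← Matrix.det_mul_row]
    rfl
  have hsq : (∏ j ∈ range n, (-1 : K) ^ (j + min p (lam.rowLen j))) *
      (∏ j ∈ range n, (-1) ^ (j + min p (lam.rowLen j))) = 1 := by
    rw [← Finset.prod_mul_distrib]
    refine Finset.prod_eq_one fun j _ => ?_
    rw [← pow_add, Even.neg_one_pow (Even.add_self _)]
  refine (congrArg Matrix.det hsub).trans ?_
  rw [Matrix.det_permute', Matrix.det_submatrix_equiv_self, hmat, Matrix.det_fromBlocks_zero₂₁,
    Matrix.det_one, mul_one, ← hdet, ← h.prod_signs, ← hsign]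
  linear_combination (-(Equiv.Perm.sign σ : K) *
    (∏ j ∈ range n, (-1 : K) ^ (m - shiftedPart n lam j)) *
      Matrix.det (Matrix.of fun j i : Fin n => a i (shiftedPart n lam j))) * hsq

end Complement

/-! ### Factorization of the block matrix -/

section Factorization

open Finset

variable {n m r p : ℕ} {lam : YoungDiagram} {K : Type*} [Field K]

/-- The entries of the block `R`, expanded in powers of `y j`: at `z = -y j` the product
`∏ q, (z + y q)` vanishes, and the divided difference is `∏ q ≠ j, (x + y q)`. -/
theorem blockR_entry (y : ℕ → K) {x x' : K} {m : ℕ} {j : ℕ} (hj : j < m)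
    (hx : ∀ q < m, x + y q ≠ 0) (hx' : ∀ q < m, x' + y q ≠ 0) :
    x / ((x + y j) * ∏ q ∈ range m, (x' + y q)) -
        x' / ((x' + y j) * ∏ q ∈ range m, (x + y q)) =
      (∏ q ∈ range m, (x + y q) * (x' + y q))⁻¹ *
        ∑ c ∈ range m, (-y j) ^ (m - 1 - c) * ospEntry y x x' m (c + 1) := by
  have hprod : ∀ z : K, (z + y j) * ∑ c ∈ range m,
      (-y j) ^ (m - 1 - c) * superComplete y z m c = ∏ q ∈ range m, (z + y q) := by
    intro z
    have h1 := sub_mul_sum_superComplete y z (-y j) m m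
    rw [superComplete_of_le y z le_rfl, superComplete_of_le y (-y j) le_rfl,
      Finset.prod_eq_zero (i := j) (f := fun q => -y j + y q) (mem_range.2 hj)
        (neg_add_cancel (y j)), Nat.sub_self, pow_zero,
      one_mul, mul_zero, sub_zero, sub_neg_eq_add] at h1
    exact h1
  have hsum : ∑ c ∈ range m, (-y j) ^ (m - 1 - c) * ospEntry y x x' m (c + 1) =
      x * ∑ c ∈ range m, (-y j) ^ (m - 1 - c) * superComplete y x m c -
        x' * ∑ c ∈ range m, (-y j) ^ (m - 1 - c) * superComplete y x' m c := by
    rw [Finset.mul_sum, Finset.mul_sum, ← Finset.sum_sub_distrib]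
    refine Finset.sum_congr rfl fun c _ => ?_
    rw [ospEntry, superComplete_succ_right y x, superComplete_succ_right y x']
    ring
  have hE : ∏ q ∈ range m, (x + y q) ≠ 0 :=
    Finset.prod_ne_zero_iff.2 fun q hq => hx q (mem_range.1 hq)
  have hE' : ∏ q ∈ range m, (x' + y q) ≠ 0 :=
    Finset.prod_ne_zero_iff.2 fun q hq => hx' q (mem_range.1 hq)
  have h1 := hx j hj
  have h2 := hx' j hj
  rw [hsum, Finset.prod_mul_distrib]
  have h3 := hprod x
  have h4 := hprod x'
  rw [mul_comm, ← eq_div_iff h1] at h3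
  rw [mul_comm, ← eq_div_iff h2] at h4
  rw [h3, h4]
  field_simp

/-- The entries of the block `X` are those of the numerators of shifted parts exceeding `m`. -/
theorem blockX_entry (y : ℕ → K) {x : K} {m l : ℕ} (hl : m ≤ l)
    (hx : ∀ q < m, x + y q ≠ 0) (hx' : ∀ q < m, x⁻¹ + y q ≠ 0) :
    x ^ ((l : ℤ) - m) / ∏ q ∈ range m, (x⁻¹ + y q) -
        x⁻¹ ^ ((l : ℤ) - m) / ∏ q ∈ range m, (x + y q) =
      (∏ q ∈ range m, (x + y q) * (x⁻¹ + y q))⁻¹ * ospEntry y x x⁻¹ m l := by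
  have hE : ∏ q ∈ range m, (x + y q) ≠ 0 :=
    Finset.prod_ne_zero_iff.2 fun q hq => hx q (mem_range.1 hq)
  have hE' : ∏ q ∈ range m, (x⁻¹ + y q) ≠ 0 :=
    Finset.prod_ne_zero_iff.2 fun q hq => hx' q (mem_range.1 hq)
  rw [ospEntry, superComplete_of_le y x hl, superComplete_of_le y x⁻¹ hl, Finset.prod_mul_distrib,
    ← Nat.cast_sub hl, zpow_natCast, zpow_natCast]
  generalize (∏ q ∈ range m, (x + y q)) = E at *
  generalize (∏ q ∈ range m, (x⁻¹ + y q)) = E' at *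
  field_simp

/-- The orthosymplectic numerators at the variables `x`. -/
def ospNumerator (m : ℕ) (x : Fin n → K) (y : ℕ → K) (i : Fin n) (l : ℕ) : K :=
  ospEntry y (x i) (x i)⁻¹ m l

/-- The block matrix of the theorem as a product of a diagonal matrix, the core matrix, and a
Vandermonde matrix in the variables `y`. -/
theorem IsSplitting.fromBlocks_eq (h : IsSplitting n m r p lam) (x : Fin n → K) (y : ℕ → K)
    (hx : ∀ i, ∀ q < m, x i + y q ≠ 0)
    (hx' : ∀ i, ∀ q < m, (x i)⁻¹ + y q ≠ 0) :
    Matrix.fromBlocks (blockR x fun j : Fin m => y j) (blockX lam x (fun j : Fin m => y j) r)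
        (blockY n lam (fun j : Fin m => y j) p) 0 =
      Matrix.fromBlocks
          (Matrix.diagonal fun i => (∏ q ∈ range m, (x i + y q) * ((x i)⁻¹ + y q))⁻¹) 0 0
          (1 : Matrix (Fin p) (Fin p) K) *
        coreMatrix n m r p lam (ospNumerator m x y) *
        Matrix.fromBlocks (Matrix.projVandermonde 1 fun j : Fin m => y j).transpose 0 0
          (1 : Matrix (Fin r) (Fin r) K) := by
  have hV : ∀ c j : Fin m, (Matrix.projVandermonde 1 fun j : Fin m => y j) j c =
      y j ^ (m - 1 - (c : ℕ)) := by
    intro c j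
    simp [Matrix.projVandermonde, Matrix.rectVandermonde, Nat.sub_sub, Nat.add_comm 1]
  rw [coreMatrix, Matrix.fromBlocks_multiply, Matrix.fromBlocks_multiply]
  simp only [Matrix.zero_mul, Matrix.mul_zero, add_zero, zero_add, Matrix.one_mul, Matrix.mul_one]
  congr 1
  · ext i j
    rw [Matrix.mul_assoc, Matrix.diagonal_mul, Matrix.mul_apply]
    simp only [blockR, Matrix.of_apply, Matrix.transpose_apply, hV]
    rw [Fin.prod_univ_eq_prod_range (fun q => (x i)⁻¹ + y q) m,
      Fin.prod_univ_eq_prod_range (fun q => x i + y q) m, blockR_entry y j.2 (hx i) (hx' i),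
      ← Fin.sum_univ_eq_sum_range
        (fun c => (-y j) ^ (m - 1 - c) * ospEntry y (x i) (x i)⁻¹ m (c + 1)) m]
    congr 1
    refine Finset.sum_congr rfl fun c _ => ?_
    rw [neg_pow, ospNumerator, Nat.sub_sub, Nat.add_comm 1]
    ring
  · ext i j
    rw [Matrix.diagonal_mul]
    simp only [blockX, Matrix.of_apply]
    have h1 : (lam.rowLen j : ℤ) + n - m - ((j : ℤ) + 1) + 1 = (shiftedPart n lam j : ℤ) - m := by
      have h2 := h.le
      unfold shiftedPart
      omega
    rw [Fin.prod_univ_eq_prod_range (fun q => (x i)⁻¹ + y q) m,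
      Fin.prod_univ_eq_prod_range (fun q => x i + y q) m, h1,
      blockX_entry y (h.gt j j.2).le (hx i) (hx' i), ospNumerator]
  · ext i j
    have h1 := h.complPart_le i.2
    have h2 := colLen_le h.rowLen_eq i
    have h3 : (lam.colLen i : ℤ) + m - n - ((i : ℤ) + 1) = (m - complPart n lam i : ℕ) := by
      unfold complPart at h1 ⊢
      omega
    have h4 : 0 < complPart n lam i := by
      unfold complPart
      omega
    rw [Matrix.mul_apply, Finset.sum_eq_single ⟨complPart n lam i - 1, by omega⟩]
    · simp only [blockY, Matrix.of_apply, Matrix.transpose_apply, hV]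
      rw [h3, zpow_natCast, if_pos (by omega), one_mul]
      congr 1
      omega
    · intro c _ hc
      rw [Matrix.of_apply, if_neg, zero_mul]
      intro h5
      exact hc (Fin.ext (by simp only; omega))
    · exact fun h5 => absurd (mem_univ _) h5

theorem IsSplitting.blockDet_eq (h : IsSplitting n m r p lam) (x : Fin n → K) (y : ℕ → K)
    (hx : ∀ i, ∀ q < m, x i + y q ≠ 0)
    (hx' : ∀ i, ∀ q < m, (x i)⁻¹ + y q ≠ 0) :
    blockDet h.size (blockR x fun j : Fin m => y j) (blockX lam x (fun j : Fin m => y j) r)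
        (blockY n lam (fun j : Fin m => y j) p) =
      (∏ i, ∏ q : Fin m, (x i + y q) * ((x i)⁻¹ + y q))⁻¹ *
        ((-1) ^ (m * n + n + r) * Matrix.det (Matrix.of fun j i : Fin n =>
          ospNumerator m x y i (shiftedPart n lam j))) *
        ∏ i : Fin m, ∏ j : Fin m with i < j, (y i - y j) := by
  let e : Fin (n + p) ≃ Fin n ⊕ Fin p := finSumFinEquiv.symm
  let f : Fin (n + p) ≃ Fin m ⊕ Fin r := (finCongr h.size).trans finSumFinEquiv.symm
  have key : ∀ (L : Matrix (Fin n ⊕ Fin p) (Fin n ⊕ Fin p) K)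
      (C : Matrix (Fin n ⊕ Fin p) (Fin m ⊕ Fin r) K)
      (W : Matrix (Fin m ⊕ Fin r) (Fin m ⊕ Fin r) K),
      ((L * C * W).submatrix e f).det = L.det * (C.submatrix e f).det * W.det := by
    intro L C W
    rw [← Matrix.submatrix_mul_equiv (L * C) W e f f, ← Matrix.submatrix_mul_equiv L C e e f,
      Matrix.det_mul, Matrix.det_mul, Matrix.det_submatrix_equiv_self,
      Matrix.det_submatrix_equiv_self]
  rw [blockDet, h.fromBlocks_eq x y hx hx']
  refine (key _ _ _).trans ?_
  rw [show ((coreMatrix n m r p lam (ospNumerator m x y)).submatrix e f).det = _ from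
    h.det_coreMatrix _, Matrix.det_fromBlocks_zero₂₁, Matrix.det_fromBlocks_zero₂₁,
    Matrix.det_one, Matrix.det_one, mul_one, mul_one, Matrix.det_diagonal, Finset.prod_inv_distrib,
    Matrix.det_transpose, Matrix.det_projVandermonde]
  congr 1
  · congr 2
    refine Finset.prod_congr rfl fun i _ => ?_
    exact (Fin.prod_univ_eq_prod_range (fun q => (x i + y q) * ((x i)⁻¹ + y q)) m).symm
  · refine Finset.prod_congr rfl fun i _ => ?_
    refine Finset.prod_congr (by ext; simp) fun j _ => ?_
    simp

end Factorization

/-! ### Specialization to the indeterminates -/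

section Generic

open Finset

variable {n m : ℕ}

/-- The index `k` is the first one, counted from one, whose shifted part is at most `m`. -/
theorem isSplitting_of_isLeast {lam : YoungDiagram} (hlam : lam.colLen 0 ≤ n) {k : ℕ}
    (hk : IsLeast (kSet n m lam) k) : IsSplitting n m (k - 1) (m + k - 1 - n) lam := by
  have h0 : lam.rowLen n = 0 := by
    by_contra h
    have := YoungDiagram.mem_iff_lt_colLen.1
      (YoungDiagram.mem_iff_lt_rowLen.2 (Nat.pos_of_ne_zero h))
    omega
  obtain ⟨⟨h1, h2⟩, h3⟩ := hk
  have h4 : k ≤ n + 1 := h3 ⟨by omega, by rw [Nat.add_sub_cancel, h0]; push_cast; omega⟩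
  refine ⟨h0, by omega, block_size ⟨⟨h1, h2⟩, h3⟩, fun j hj => ?_, fun j hj hkj => ?_⟩
  · by_contra! h5
    have : k ≤ j + 1 := h3 ⟨by omega, by
      unfold shiftedPart at h5
      rw [Nat.add_sub_cancel]
      push_cast
      omega⟩
    omega
  · have := lam.rowLen_anti _ _ hkj
    unfold shiftedPart
    omega

/-- A polynomial with a nonzero value at an integer point is nonzero in the field of fractions. -/
theorem algebraMap_ne_zero_of_eval (v : Fin n ⊕ Fin m → ℤ) {q : MvPolynomial (Fin n ⊕ Fin m) ℤ}
    (hq : MvPolynomial.eval v q ≠ 0) :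
    algebraMap (MvPolynomial (Fin n ⊕ Fin m) ℤ) (XYField n m) q ≠ 0 := by
  intro h
  rw [map_eq_zero_iff _ (IsFractionRing.injective _ _)] at h
  rw [h, map_zero] at hq
  exact hq rfl

theorem xVar_ne_zero (i : Fin n) : xVar n m i ≠ 0 :=
  algebraMap_ne_zero_of_eval (fun _ => 1) (by simp)

theorem xVar_add_yVar_ne_zero (i : Fin n) (j : Fin m) : xVar n m i + yVar n m j ≠ 0 := by
  rw [xVar, yVar, ← map_add]
  exact algebraMap_ne_zero_of_eval (fun _ => 1) (by simp)

theorem inv_xVar_add_yVar_ne_zero (i : Fin n) (j : Fin m) :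
    (xVar n m i)⁻¹ + yVar n m j ≠ 0 := by
  have h1 : 1 + xVar n m i * yVar n m j ≠ 0 := by
    rw [xVar, yVar, ← map_mul, ← map_one (algebraMap (MvPolynomial (Fin n ⊕ Fin m) ℤ) _),
      ← map_add]
    exact algebraMap_ne_zero_of_eval (fun _ => 1) (by simp)
  intro h
  apply h1
  rw [← mul_inv_cancel₀ (xVar_ne_zero (m := m) i), ← mul_add, h, mul_zero]

theorem xVar_sub_inv_ne_zero (i : Fin n) : xVar n m i - (xVar n m i)⁻¹ ≠ 0 := by
  have h1 : xVar n m i * xVar n m i - 1 ≠ 0 := by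
    rw [xVar, ← map_mul, ← map_one (algebraMap (MvPolynomial (Fin n ⊕ Fin m) ℤ) _), ← map_sub]
    exact algebraMap_ne_zero_of_eval (fun _ => 2) (by simp)
  intro h
  apply h1
  have h2 := mul_inv_cancel₀ (xVar_ne_zero (m := m) i)
  linear_combination xVar n m i * h + h2

theorem xVar_vandermonde_ne_zero {i j : Fin n} (hij : i ≠ j) :
    xVar n m i + (xVar n m i)⁻¹ - xVar n m j - (xVar n m j)⁻¹ ≠ 0 := by
  have h1 : xVar n m i - xVar n m j ≠ 0 := by
    rw [xVar, xVar, ← map_sub]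
    exact algebraMap_ne_zero_of_eval (fun a => if a = Sum.inl i then 1 else 0)
      (by simp [hij.symm])
  have h2 : xVar n m i * xVar n m j - 1 ≠ 0 := by
    rw [xVar, xVar, ← map_mul, ← map_one (algebraMap (MvPolynomial (Fin n ⊕ Fin m) ℤ) _),
      ← map_sub]
    exact algebraMap_ne_zero_of_eval (fun _ => 2) (by simp)
  have hi := xVar_ne_zero (m := m) i
  have hj := xVar_ne_zero (m := m) j
  intro h
  apply mul_ne_zero h1 h2
  have h3 : (xVar n m i - xVar n m j) * (xVar n m i * xVar n m j - 1) =
      xVar n m i * xVar n m j *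
        (xVar n m i + (xVar n m i)⁻¹ - xVar n m j - (xVar n m j)⁻¹) := by
    field_simp
    ring
  rw [h3, h, mul_zero]

theorem yVar_sub_ne_zero {i j : Fin m} (hij : i ≠ j) : yVar n m i - yVar n m j ≠ 0 := by
  rw [yVar, yVar, ← map_sub]
  exact algebraMap_ne_zero_of_eval (fun a => if a = Sum.inr i then 1 else 0)
    (by simp [hij.symm])

end Generic

theorem theorem1p2 (n m : ℕ) (hn : 0 < n) (hm : 0 < m) (lam : YoungDiagram)
    (hlam : lam.colLen 0 ≤ n) (k : ℕ) (hk : IsLeast (kSet n m lam) k) :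
    spo lam (xVar n m) (yVar n m) =
      (-1 : XYField n m) ^ ((m : ℤ) * n - n + k - 1) / spoD (xVar n m) (yVar n m) *
        blockDet (block_size hk)
          (blockR (xVar n m) (yVar n m))
          (blockX lam (xVar n m) (yVar n m) (k - 1))
          (blockY n lam (yVar n m) (m + k - 1 - n)) := by
  have hs := isSplitting_of_isLeast hlam hk
  -- The weights of the letters as a function of the rank.
  let w : ℕ → XYField n m :=
    Function.extend (OSPLetter.rank (n := n) (m := m)) (OSPLetter.wt (xVar n m) (yVar n m)) 0
  have hw : ∀ a : OSPLetter n m, w a.rank = a.wt (xVar n m) (yVar n m) :=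
    fun a => OSPLetter.rank_injective.extend_apply _ _ a
  have hw0 : ∀ i : Fin n, w (2 * i) = xVar n m i := fun i => hw (Sum.inl (i, false))
  have hw1 : ∀ i : Fin n, w (2 * i + 1) = (xVar n m i)⁻¹ := fun i => hw (Sum.inl (i, true))
  have hwy : (fun j : Fin m => w (2 * n + j)) = yVar n m := funext fun j => hw (Sum.inr j)
  have hwy' : ∀ j : Fin m, w (2 * n + j) = yVar n m j := congrFun hwy
  have hspo := mul_rankSum_eq_det_ospEntry n w
    (fun i hi => by
      rw [hw0 ⟨i, hi⟩, hw1 ⟨i, hi⟩]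
      exact mul_inv_cancel₀ (xVar_ne_zero _)) m lam hs.rowLen_eq
  rw [← spo_eq_rankSum lam _ _ w hw] at hspo
  have hdet := hs.blockDet_eq (xVar n m) (fun q => w (2 * n + q))
    (fun i q hq => by rw [hwy' ⟨q, hq⟩]; exact xVar_add_yVar_ne_zero _ _)
    (fun i q hq => by rw [hwy' ⟨q, hq⟩]; exact inv_xVar_add_yVar_ne_zero _ _)
  rw [hwy] at hdet
  simp only [ospNumerator] at hdet
  simp only [hw0, hw1, vandProd] at hspo
  rw [hdet, ← hspo, spoD]
  simp only [hwy', ← sub_sub]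
  have hX : ∏ i, (xVar n m i - (xVar n m i)⁻¹) ≠ 0 :=
    Finset.prod_ne_zero_iff.2 fun i _ => xVar_sub_inv_ne_zero i
  have hV : ∏ i, ∏ j with i < j,
      (xVar n m i + (xVar n m i)⁻¹ - xVar n m j - (xVar n m j)⁻¹) ≠ 0 :=
    Finset.prod_ne_zero_iff.2 fun i _ => Finset.prod_ne_zero_iff.2 fun j hj =>
      xVar_vandermonde_ne_zero (Finset.mem_filter.1 hj).2.ne
  have hY : ∏ i, ∏ j with i < j, (yVar n m i - yVar n m j) ≠ 0 :=
    Finset.prod_ne_zero_iff.2 fun i _ => Finset.prod_ne_zero_iff.2 fun j hj =>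
      yVar_sub_ne_zero (Finset.mem_filter.1 hj).2.ne
  have hP : ∏ i, ∏ j, (xVar n m i + yVar n m j) * ((xVar n m i)⁻¹ + yVar n m j) ≠ 0 :=
    Finset.prod_ne_zero_iff.2 fun i _ => Finset.prod_ne_zero_iff.2 fun j _ =>
      mul_ne_zero (xVar_add_yVar_ne_zero i j) (inv_xVar_add_yVar_ne_zero i j)
  have hsign : (-1 : XYField n m) ^ ((m : ℤ) * n - n + k - 1) *
      (-1) ^ (m * n + n + (k - 1)) = 1 := by
    have h1 := hk.1.1
    rw [← zpow_natCast, ← zpow_add₀ (by simp)]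
    refine Even.neg_one_zpow ⟨m * n + k - 1, ?_⟩
    push_cast [Nat.cast_sub h1]
    ring
  generalize (∏ i, (xVar n m i - (xVar n m i)⁻¹)) = A at *
  generalize (∏ i, ∏ j with i < j,
    (xVar n m i + (xVar n m i)⁻¹ - xVar n m j - (xVar n m j)⁻¹)) = B at *
  generalize (∏ i, ∏ j with i < j, (yVar n m i - yVar n m j)) = C at *
  generalize (∏ i, ∏ j, (xVar n m i + yVar n m j) * ((xVar n m i)⁻¹ + yVar n m j)) = P at *
  generalize (-1 : XYField n m) ^ ((m : ℤ) * n - n + k - 1) = s at *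
  generalize (-1 : XYField n m) ^ (m * n + n + (k - 1)) = s' at *
  field_simp
  linear_combination (-spo lam (xVar n m) (yVar n m)) * hsign
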